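/- Let $K$ be a field of characteristic $0$ with algebraic closure $\overline K$ and absolute Galois group $G_K$, let $E/K$ be an elliptic curve, and let $e_3$ be the Weil pairing on $E[3]\subset E(\overline K)$, with $e_3^{1/2}$ its square root with values in $\mu_3$. For a finite set $X$ with Galois action let $\operatorname{Map}_K(X,\overline K)$ be the étale $K$-algebra of Galois-equivariant maps $X\to\overline K$. Let $\Lambda$ be the set of affine lines of the $\mathbb F_3$-vector space $E[3]$ that do not pass through $0$, and let $R,L,L',M$ be the étale algebras of $E[3]$, $E[3]\setminus\{0\}$, $\Lambda$ and $\{(T,\lambda): T\in\lambda\in\Lambda\}$. There are natural inclusions $L\subset M$ and $L'\subset M$. Elements of $R\otimes_K R$ are regarded as functions on $E[3]\times E[3]$. Let $\xi\in H^1(K,E[3])$. Say that $\alpha\in L^\times$ and $\rho\in(R\otimes_K R)^\times$ are compatible representatives (for the images $w_1(\xi)\in L^\times/(L^\times)^3$ and $w_2(\xi)$ of $\xi$) if there are a cocycle $(\sigma\mapsto\xi_\sigma)$ representing $\xi$ and a map $\gamma:E[3]\to\overline K^\times$ such that $e_3(\xi_\sigma,T)=(\sigma\gamma/\gamma)(T)$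 for all $\sigma\in G_K$, $T\in E[3]$, where $(\sigma\gamma)(T)=\sigma(\gamma(\sigma^{-1}T))$; $\gamma(0)=1$ and $\gamma(T)^3=\alpha(T)$ for $T\ne0$; and $\rho(S,T)=\gamma(S)\gamma(T)/\gamma(S+T)$ for all $S,T\in E[3]$. For $f,g:E[3]\to\overline K$ put $$(f*_\rho g)(T)=\sum_{T_1+T_2=T}e_3^{1/2}(T_1,T_2)\,\rho(T_1,T_2)\,f(T_1)\,g(T_2),$$ and let $\delta_0$ and $\delta_\lambda$ be the indicator functions of $\{0\}$ and of $\lambda\in\Lambda$. Let $\alpha,\rho$ be compatible representatives for some $\xi\in H^1(K,E[3])$. Then there is $\alpha'\in L'$ such that, for every $\lambda\in\Lambda$, both bracketings of the triple product satisfy $$\delta_\lambda*_\rho\delta_\lambda*_\rho\delta_\lambda=\alpha'(\lambda)\,\delta_0,$$ and, for every labelling $\lambda=\{S_1,S_2,S_3\}$, $$\alpha'(\lambda)=\alpha(S_1)+\alpha(S_2)+\alpha(S_3)-3\,\rho(S_1,S_2)\,\rho(S_3,-S_3).$$ Moreover there is $s\in L'$ with $s^3=N_{M/L'}(\alpha)$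 and $\alpha'=\operatorname{Tr}_{M/L'}(\alpha)-3s$. -/

import Mathlib

open scoped TensorProduct

namespace CasselsTate

noncomputable section

/-! ### The Weil pairing -/

section Weil

open WeierstrassCurve

variable {F : Type*} [Field F] (W : WeierstrassCurve.Affine F)

/-- The ideal of the affine coordinate ring `F[W]` of functions vanishing at a point; for the point
at infinity, it is the unit ideal. -/
def pointIdeal : W.Point → Ideal W.CoordinateRing
  | .zero => ⊤
  | .some x y _ => Affine.CoordinateRing.XYIdeal W x (Polynomial.C y)

/-- The value of a function in `F[W]` at an affine point (with junk value `0` at infinity). -/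
def evalAt (f : W.CoordinateRing) : W.Point → F
  | .zero => 0
  | .some _ _ h => AdjoinRoot.evalEval h.1 f

/-- `z` is a value of the Weil pairing `e_n(P, Q)` of two `n`-torsion points. Here a generator `f`
of the `n`-th power of the ideal of `P` is a function with divisor `n(P) - n(O)` (such a function
has no poles outside infinity), `g` is a function with divisor `n(Q) - n(O)`, and `X` is an
auxiliary point at which everything is defined and nonzero; then
`e_n(P, Q) = (f(Q + X) / f(X)) / (g(P - X) / g(-X))`. -/
def IsWeilValue [DecidableEq F] (n : ℕ) (P Q : W.Point) (z : F) : Prop :=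
  ∃ (f g : W.CoordinateRing) (X : W.Point),
    Ideal.span {f} = pointIdeal W P ^ n ∧ Ideal.span {g} = pointIdeal W Q ^ n ∧
    X ≠ 0 ∧ X ≠ P ∧ X ≠ -Q ∧ X ≠ P - Q ∧
    z = (evalAt W f (Q + X) / evalAt W f X) / (evalAt W g (P - X) / evalAt W g (-X))

/-- The Weil pairing `e_n(P, Q)` of two `n`-torsion points of an elliptic curve over an
algebraically closed field. -/
def weilPairing [DecidableEq F] (n : ℕ) (P Q : W.Point) : F :=
  Classical.epsilon (IsWeilValue W n P Q)

end Weil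

/-! ### Étale algebras of sets with Galois action -/

instance decEqAlgebraicClosure (K : Type*) [Field K] : DecidableEq (AlgebraicClosure K) :=
  Classical.decEq _

/-- The absolute Galois group, with the Krull topology. -/
abbrev GK (K : Type*) [Field K] : Type _ := AlgebraicClosure K ≃ₐ[K] AlgebraicClosure K

section Etale

variable (K : Type*) [Field K]

/-- The étale algebra `Map_K(X, K̄)` of Galois-equivariant maps from `X` to `K̄`. -/
def etaleAlgebra (X : Type*) [MulAction (GK K) X] :
    Subalgebra K (X → AlgebraicClosure K) where
  carrier := {f | ∀ (σ : GK K) (x : X), f (σ • x) = σ (f x)}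
  mul_mem' := by
    intro f g hf hg σ x
    simp [hf σ x, hg σ x]
  add_mem' := by
    intro f g hf hg σ x
    simp [hf σ x, hg σ x]
  algebraMap_mem' := by
    intro r σ x
    simp [Pi.algebraMap_apply]

variable {K}

/-- An equivariant map `X → Y` induces `Map_K(Y, K̄) → Map_K(X, K̄)`. -/
def etalePullback {X Y : Type*} [MulAction (GK K) X] [MulAction (GK K) Y] (φ : X →[GK K] Y) :
    etaleAlgebra K Y →ₐ[K] etaleAlgebra K X where
  toFun f := ⟨fun x => f.1 (φ x), fun σ x =>
    (congrArg f.1 (map_smul φ σ x)).trans (f.2 σ (φ x))⟩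
  map_one' := rfl
  map_mul' _ _ := rfl
  map_zero' := rfl
  map_add' _ _ := rfl
  commutes' _ := rfl

end Etale

variable {K : Type*} [Field K] (E : WeierstrassCurve K) (p : ℕ)

/-! ### The Galois module `E[p]` -/

/-- The group `E(K̄)`. -/
abbrev GeomPoint : Type _ :=
  (WeierstrassCurve.Affine.baseChange E (AlgebraicClosure K)).Point

/-- The `p`-torsion subgroup `E[p]` of `E(K̄)`. -/
abbrev Tors : Type _ := AddSubgroup.torsionBy (GeomPoint E) (p : ℤ)

/-- The action of an element of the Galois group on `E(K̄)`. -/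
def galMap (σ : GK K) : GeomPoint E →+ GeomPoint E :=
  WeierstrassCurve.Affine.Point.map (W' := E)
    (σ : AlgebraicClosure K →ₐ[K] AlgebraicClosure K)

instance torsAction : DistribMulAction (GK K) (Tors E p) where
  smul σ T := ⟨galMap E σ T.1, by
    have h : (p : ℤ) • T.1 = 0 := T.2
    change (p : ℤ) • galMap E σ T.1 = 0
    rw [← map_zsmul, h, map_zero]⟩
  one_smul T := by
    apply Subtype.ext
    change galMap E 1 T.1 = T.1
    rcases T.1 with _ | _ <;> rfl
  mul_smul σ τ T := by
    apply Subtype.ext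
    change galMap E (σ * τ) T.1 = galMap E σ (galMap E τ T.1)
    rcases T.1 with _ | _ <;> rfl
  smul_zero σ := rfl
  smul_add σ S T := Subtype.ext (map_add (galMap E σ) S.1 T.1)

/-- The Weil pairing on `E[p]`. -/
def weil (S T : Tors E p) : AlgebraicClosure K :=
  weilPairing (WeierstrassCurve.Affine.baseChange E (AlgebraicClosure K)) p S.1 T.1

/-- The square root in `μ_p` of the Weil pairing, for odd `p`. -/
def weilSqrt (S T : Tors E p) : AlgebraicClosure K := weil E p S T ^ ((p + 1) / 2)

/-! ### The finite sets `E[p] ∖ {0}`, `Λ` and `{(T, ℓ) : T ∈ ℓ}` with Galois action -/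

/-- `E[p] ∖ {0}`. -/
abbrev NonzeroTors : Type _ := {T : Tors E p // T ≠ 0}

instance nonzeroTorsAction : MulAction (GK K) (NonzeroTors E p) where
  smul σ T := ⟨σ • T.1, (smul_ne_zero_iff_ne σ).mpr T.2⟩
  one_smul T := Subtype.ext (one_smul _ T.1)
  mul_smul σ τ T := Subtype.ext (mul_smul σ τ T.1)

/-- Affine lines in the `𝔽_p`-vector space `E[p]`, `p` prime. -/
def IsAffineLine (l : Set (Tors E p)) : Prop :=
  ∃ S D : Tors E p, D ≠ 0 ∧ l = {T | ∃ k : ℤ, T = S + k • D}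

/-- The set `Λ` of lines in `E[p]` that do not pass through `0`. -/
abbrev LineSet : Type _ := {l : Set (Tors E p) // IsAffineLine E p l ∧ (0 : Tors E p) ∉ l}

instance lineSetAction : MulAction (GK K) (LineSet E p) where
  smul σ l := ⟨(fun T => σ • T) '' l.1, by
    obtain ⟨l, ⟨S, D, hD, rfl⟩, h0⟩ := l
    refine ⟨⟨σ • S, σ • D, (smul_ne_zero_iff_ne σ).mpr hD, ?_⟩, ?_⟩
    · have hz (k : ℤ) : σ • (k • D) = k • (σ • D) :=
        map_zsmul (DistribSMul.toAddMonoidHom (Tors E p) σ) k D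
      ext T
      constructor
      · rintro ⟨_, ⟨k, rfl⟩, rfl⟩
        exact ⟨k, by simp only [smul_add, hz]⟩
      · rintro ⟨k, rfl⟩
        exact ⟨S + k • D, ⟨k, rfl⟩, by simp only [smul_add, hz]⟩
    · rintro ⟨T, hT, h⟩
      rw [(smul_eq_zero_iff_eq σ).mp h] at hT
      exact h0 hT⟩
  one_smul l := Subtype.ext (by
    change (fun T => (1 : GK K) • T) '' l.1 = l.1
    simp)
  mul_smul σ τ l := Subtype.ext (by
    change (fun T => (σ * τ) • T) '' l.1 = (fun T => σ • T) '' ((fun T => τ • T) '' l.1)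
    simp [Set.image_image, mul_smul])

/-- The set of pairs `(T, l)` with `T` a nonzero `p`-torsion point on a line `l ∈ Λ`. -/
abbrev Flags : Type _ := {x : NonzeroTors E p × LineSet E p // x.1.1 ∈ x.2.1}

instance flagsAction : MulAction (GK K) (Flags E p) where
  smul σ x := ⟨(σ • x.1.1, σ • x.1.2), Set.mem_image_of_mem (fun T => σ • T) x.2⟩
  one_smul x := Subtype.ext (Prod.ext (one_smul _ x.1.1) (one_smul _ x.1.2))
  mul_smul σ τ x := Subtype.ext (Prod.ext (mul_smul σ τ x.1.1) (mul_smul σ τ x.1.2))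

/-- The étale algebra `R` of `E[p]`. -/
abbrev algR : Type _ := etaleAlgebra K (Tors E p)

/-- The étale algebra `L` of `E[p] ∖ {0}`. -/
abbrev algL : Type _ := etaleAlgebra K (NonzeroTors E p)

/-- The étale algebra `L'` of `Λ`. -/
abbrev algL' : Type _ := etaleAlgebra K (LineSet E p)

/-- The étale algebra `M` of `{(T, l) : T ∈ l ∈ Λ}`. -/
abbrev algM : Type _ := etaleAlgebra K (Flags E p)

/-- The natural inclusion `L ⊂ M`, induced by `(T, l) ↦ T`. -/
def inclLM : algL E p →ₐ[K] algM E p :=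
  etalePullback { toFun := fun x => x.1.1, map_smul' := fun _ _ => rfl }

/-- The natural inclusion `L' ⊂ M`, induced by `(T, l) ↦ l`. -/
def inclL'M : algL' E p →ₐ[K] algM E p :=
  etalePullback { toFun := fun x => x.1.2, map_smul' := fun _ _ => rfl }

instance algebraL'M : Algebra (algL' E p) (algM E p) := (inclL'M E p).toRingHom.toAlgebra

/-! ### The group `H¹(K, E[p])` -/

/-- Continuous cocycles `G_K → E[p]`, where `E[p]` is discrete. -/
def cocycles : AddSubgroup (GK K → Tors E p) where
  carrier := {c | IsLocallyConstant c ∧ ∀ σ τ : GK K, c (σ * τ) = c σ + σ • c τ}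
  add_mem' := by
    rintro c d ⟨hc, hc'⟩ ⟨hd, hd'⟩
    refine ⟨hc.add hd, fun σ τ => ?_⟩
    simp only [Pi.add_apply, hc' σ τ, hd' σ τ, smul_add]
    abel
  zero_mem' := ⟨IsLocallyConstant.const 0, fun σ τ => by simp⟩
  neg_mem' := by
    rintro c ⟨hc, hc'⟩
    refine ⟨hc.neg, fun σ τ => ?_⟩
    simp only [Pi.neg_apply, hc' σ τ, smul_neg]
    abel

/-- Coboundaries `σ ↦ σ a - a`. -/
def coboundaries : AddSubgroup (cocycles E p) where
  carrier := {c | ∃ a : Tors E p, ∀ σ : GK K, c.1 σ = σ • a - a}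
  add_mem' := by
    rintro c d ⟨a, ha⟩ ⟨b, hb⟩
    refine ⟨a + b, fun σ => ?_⟩
    change c.1 σ + d.1 σ = _
    rw [ha, hb, smul_add]
    abel
  zero_mem' := ⟨0, fun σ => by simp⟩
  neg_mem' := by
    rintro c ⟨a, ha⟩
    refine ⟨-a, fun σ => ?_⟩
    change -c.1 σ = _
    rw [ha, smul_neg]
    abel

/-- The Galois cohomology group `H¹(K, E[p])`. -/
abbrev H1 : Type _ := cocycles E p ⧸ coboundaries E p

/-! ### Compatible representatives and the multiplication `*_ρ` -/

/-- The value `ρ(S, T)` of `ρ ∈ R ⊗_K R` at `(S, T)`; thus `(f ⊗ g)(S, T) = f(S) g(T)`. -/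
def pairValue (ρ : algR E p ⊗[K] algR E p) (S T : Tors E p) : AlgebraicClosure K :=
  Algebra.TensorProduct.productMap
    ((Pi.evalAlgHom K (fun _ : Tors E p => AlgebraicClosure K) S).comp
      (etaleAlgebra K (Tors E p)).val)
    ((Pi.evalAlgHom K (fun _ : Tors E p => AlgebraicClosure K) T).comp
      (etaleAlgebra K (Tors E p)).val) ρ

/-- `α ∈ Lˣ` and `ρ ∈ (R ⊗_K R)ˣ` are compatible representatives for `w₁(ξ)` and `w₂(ξ)`. The
Galois action on `γ : E[p] → K̄ˣ` is `(σγ)(T) = σ(γ(σ⁻¹T))`. -/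
def Compatible (ξ : H1 E p) (α : (algL E p)ˣ) (ρ : (algR E p ⊗[K] algR E p)ˣ) : Prop :=
  ∃ (c : cocycles E p) (γ : Tors E p → (AlgebraicClosure K)ˣ),
    QuotientAddGroup.mk c = ξ ∧
    (∀ (σ : GK K) (T : Tors E p),
      weil E p (c.1 σ) T = σ (γ (σ⁻¹ • T) : AlgebraicClosure K) / γ T) ∧
    γ 0 = 1 ∧
    (∀ T : NonzeroTors E p, (γ T.1 : AlgebraicClosure K) ^ p = α.val.1 T) ∧
    ∀ S T : Tors E p, pairValue E p ρ.val S T = γ S * γ T / γ (S + T)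

/-- The multiplication `*_ρ` on `Map(E[p], K̄)`:
`(f *_ρ g)(T) = ∑_{T₁ + T₂ = T} e_p^{1/2}(T₁, T₂) ρ(T₁, T₂) f(T₁) g(T₂)`. -/
def starMul (ρ : algR E p ⊗[K] algR E p) (f g : Tors E p → AlgebraicClosure K) :
    Tors E p → AlgebraicClosure K := fun T =>
  ∑ᶠ T₁ : Tors E p,
    weilSqrt E p T₁ (T - T₁) * pairValue E p ρ T₁ (T - T₁) * f T₁ * g (T - T₁)

/-- The indicator function `δ_X` of a set `X` of `p`-torsion points. -/
def delta (X : Set (Tors E p)) : Tors E p → AlgebraicClosure K := Set.indicator X 1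

end

end CasselsTate

open CasselsTate

open scoped TensorProduct

namespace CasselsTate

noncomputable section

/-! ### Tangent lines at the flexes of a Weierstrass cubic -/

section Flex

open WeierstrassCurve

variable {F : Type*} [Field F] [DecidableEq F] {W : WeierstrassCurve.Affine F}

/-! Write the points of a line as S + iD with i in 𝔽₃. Since `ρ` is the coboundary of `γ` and
e₃^{1/2} is bilinear, the term of either triple product indexed by (i, j, k) is γᵢγⱼγₖ / γ((i+j+k)D)
times z^(i-k), placed at (i+j+k)D, where z = e₃^{1/2}(S, D). The line avoids 0, so S and D are
independent and z is a primitive cube root of unity. Away from 0 the three orderings of each index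
multiset contribute 1 + z + z² = 0. At 0 the diagonal terms give ∑ γᵢ³ and the six permutations give
3(z + z²)∏ γᵢ = -3∏ γᵢ (`sum_cube_root`, `starMul_triple`).

Put s(λ) = ∏_{T ∈ λ} γ(T). The points of λ sum to 0, so applying σ changes s by e₃(ξ_σ, 0) = 1,
whence s lies in `L'` (`lineProduct`). As γ³ = α, the product formula for the norm and the sum
formula for the trace (`norm_algM_apply`, `trace_algM_apply`) give s³ = N(α) and the coefficient
Tr(α) - 3s. The formula in `ρ` follows by telescoping.

The pairing is defined by arbitrary functions and an auxiliary point, so its bilinearity,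
alternation and nondegeneracy on E[3] must be proved. A nonzero 3-torsion point P is a flex, and its
tangent form t_P has divisor 3(P) - 3(O). Translation by Q sends t_P to a constant times t_{P-Q} /
t_{-Q} (`tangentVal_add`), from which the properties of the pairing follow by cancellation.
Nondegeneracy compares the slopes of two flex tangents. -/

/-- The affine form defining the tangent line at `P`, normalised to be monic in `y`; it is the
constant `1` for the point at infinity. -/
def tangentForm : W.Point → F → F → F
  | .zero => fun _ _ => 1
  | .some x₀ y₀ _ => fun x y => y - y₀ - W.slope x₀ x₀ y₀ y₀ * (x - x₀)

/-- The value of the tangent form at `P` in a point (with junk value `0` at infinity). -/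
def tangentVal (P : W.Point) : W.Point → F
  | .zero => 0
  | .some x y _ => tangentForm P x y

/-- The sign relating the tangent forms at `P` and at `-P`. -/
def tangentSign : W.Point → F
  | .zero => 1
  | .some _ _ _ => -1

@[simp]
lemma tangentVal_some (P : W.Point) {x y : F} (h : W.Nonsingular x y) :
    tangentVal P (.some x y h) = tangentForm P x y := rfl

@[simp]
lemma tangentForm_some {x₀ y₀ : F} (h : W.Nonsingular x₀ y₀) (x y : F) :
    tangentForm (.some x₀ y₀ h) x y = y - y₀ - W.slope x₀ x₀ y₀ y₀ * (x - x₀) := rfl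

lemma tangentVal_zero_left {X : W.Point} (hX : X ≠ 0) : tangentVal 0 X = 1 := by
  rcases X with _ | ⟨x, y, h⟩
  · exact absurd rfl hX
  · rfl

omit [DecidableEq F] in
lemma tangentSign_ne_zero (P : W.Point) : tangentSign P ≠ 0 := by
  rcases P with _ | _ <;> simp [tangentSign]

lemma add_self_of_three_zsmul {P : W.Point} (h3 : (3 : ℤ) • P = 0) : P + P = -P := by
  rw [eq_neg_iff_add_eq_zero, ← h3]
  abel

omit [DecidableEq F] in
lemma tangentSign_mul_self (P : W.Point) : tangentSign P * tangentSign P = 1 := by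
  rcases P with _ | _ <;> simp [tangentSign]

lemma neg_ne_self_of_three_zsmul {P : W.Point} (hP : P ≠ 0) (h3 : (3 : ℤ) • P = 0) : P ≠ -P := by
  intro h
  apply hP
  have h2 : P + P = 0 := by nth_rw 2 [h]; exact add_neg_cancel P
  have : (3 : ℤ) • P = P + P + P := by abel
  rwa [this, h2, zero_add] at h3

lemma flex_ne {x₀ y₀ : F} {h : W.Nonsingular x₀ y₀}
    (h3 : (3 : ℤ) • Affine.Point.some x₀ y₀ h = 0) : y₀ ≠ W.negY x₀ y₀ := by
  intro hy
  apply neg_ne_self_of_three_zsmul (Affine.Point.some_ne_zero h) h3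
  simp only [Affine.Point.neg_some, Affine.Point.some.injEq, true_and]
  exact hy

lemma slope_flex {x₀ y₀ : F} {h : W.Nonsingular x₀ y₀}
    (h3 : (3 : ℤ) • Affine.Point.some x₀ y₀ h = 0) :
    W.slope x₀ x₀ y₀ y₀ * (2 * y₀ + W.a₁ * x₀ + W.a₃) =
      3 * x₀ ^ 2 + 2 * W.a₂ * x₀ + W.a₄ - W.a₁ * y₀ := by
  have hy := flex_ne h3
  rw [Affine.slope_of_Y_ne rfl hy, div_mul_eq_mul_div, div_eq_iff (sub_ne_zero.mpr hy)]
  simp only [Affine.negY]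
  ring

/-- At a flex 2P = -P has the same x-coordinate as P; this is the doubling formula for that
coordinate. -/
lemma three_mul_x_flex {x₀ y₀ : F} {h : W.Nonsingular x₀ y₀}
    (h3 : (3 : ℤ) • Affine.Point.some x₀ y₀ h = 0) :
    3 * x₀ = W.slope x₀ x₀ y₀ y₀ ^ 2 + W.a₁ * W.slope x₀ x₀ y₀ y₀ - W.a₂ := by
  have hy := flex_ne h3
  have h2 := add_self_of_three_zsmul h3
  rw [Affine.Point.add_self_of_Y_ne hy, Affine.Point.neg_some, Affine.Point.some.injEq] at h2
  have := h2.1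
  simp only [Affine.addX] at this
  linear_combination -this

lemma two_mul_y_ne_zero_flex {x₀ y₀ : F} {h : W.Nonsingular x₀ y₀}
    (h3 : (3 : ℤ) • Affine.Point.some x₀ y₀ h = 0) : 2 * y₀ + W.a₁ * x₀ + W.a₃ ≠ 0 := by
  intro hd
  apply flex_ne h3
  simp only [Affine.negY]
  linear_combination hd

lemma slope_neg_flex {x₀ y₀ : F} {h : W.Nonsingular x₀ y₀}
    (h3 : (3 : ℤ) • Affine.Point.some x₀ y₀ h = 0) :
    W.slope x₀ x₀ (W.negY x₀ y₀) (W.negY x₀ y₀) = -W.slope x₀ x₀ y₀ y₀ - W.a₁ := by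
  have h3' : (3 : ℤ) • (-Affine.Point.some x₀ y₀ h) = 0 := by
    rw [smul_neg, h3, _root_.neg_zero]
  rw [Affine.Point.neg_some] at h3'
  have e := slope_flex h3'
  have e' := slope_flex h3
  have hd := two_mul_y_ne_zero_flex h3
  simp only [Affine.negY] at e ⊢
  apply mul_right_cancel₀ hd
  linear_combination -e + e'

/-- The Weierstrass equation in coordinates adapted to a flex. -/
lemma flex_equation {x₀ y₀ x y : F} {h : W.Nonsingular x₀ y₀}
    (h3 : (3 : ℤ) • Affine.Point.some x₀ y₀ h = 0) (hX : W.Equation x y) :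
    tangentForm (.some x₀ y₀ h) x y ^ 2 +
      (W.a₁ + 2 * W.slope x₀ x₀ y₀ y₀) * (x - x₀) * tangentForm (.some x₀ y₀ h) x y +
      (2 * y₀ + W.a₁ * x₀ + W.a₃) * tangentForm (.some x₀ y₀ h) x y = (x - x₀) ^ 3 := by
  have e1 := slope_flex h3
  have e2 := three_mul_x_flex h3
  have e3 := (Affine.equation_iff _ _).mp hX
  have e4 := (Affine.equation_iff _ _).mp h.1
  simp only [tangentForm_some]
  linear_combination e3 - e4 - (x - x₀) * e1 + (x - x₀) ^ 2 * e2

lemma equation_of_flex_equation {x₀ y₀ u v : F} {h : W.Nonsingular x₀ y₀}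
    (h3 : (3 : ℤ) • Affine.Point.some x₀ y₀ h = 0)
    (e : v ^ 2 + (W.a₁ + 2 * W.slope x₀ x₀ y₀ y₀) * u * v +
      (2 * y₀ + W.a₁ * x₀ + W.a₃) * v = u ^ 3) :
    W.Equation (x₀ + u) (y₀ + W.slope x₀ x₀ y₀ y₀ * u + v) := by
  have e1 := slope_flex h3
  have e2 := three_mul_x_flex h3
  have e4 := (Affine.equation_iff _ _).mp h.1
  rw [Affine.equation_iff]
  linear_combination e + e4 + u * e1 - u ^ 2 * e2

lemma tangentForm_neg {x₀ y₀ : F} {h : W.Nonsingular x₀ y₀}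
    (h3 : (3 : ℤ) • Affine.Point.some x₀ y₀ h = 0) (x y : F) :
    tangentForm (-Affine.Point.some x₀ y₀ h) x y =
      tangentForm (.some x₀ y₀ h) x y + (W.a₁ + 2 * W.slope x₀ x₀ y₀ y₀) * (x - x₀) +
        (2 * y₀ + W.a₁ * x₀ + W.a₃) := by
  rw [Affine.Point.neg_some, tangentForm_some, tangentForm_some, slope_neg_flex h3]
  simp only [Affine.negY]
  ring

lemma three_zsmul_neg {P : W.Point} (h3 : (3 : ℤ) • P = 0) : (3 : ℤ) • (-P) = 0 := by
  rw [smul_neg, h3, _root_.neg_zero]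

lemma tangentVal_neg {P : W.Point} (h3 : (3 : ℤ) • P = 0) (X : W.Point) :
    tangentVal P (-X) = tangentSign P * tangentVal (-P) X := by
  rcases X with _ | ⟨x, y, hX⟩
  · change (0 : F) = _ * 0
    rw [mul_zero]
  rcases P with _ | ⟨x₀, y₀, h⟩
  · change (1 : F) = 1 * 1
    rw [mul_one]
  · rw [tangentVal_some, tangentForm_neg h3, Affine.Point.neg_some, tangentVal_some,
      tangentForm_some, tangentForm_some]
    simp only [Affine.negY, tangentSign]
    ring

omit [DecidableEq F] in
lemma tangentSign_neg (P : W.Point) : tangentSign (-P) = tangentSign P := by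
  rcases P with _ | _ <;> rfl

/-- On the tangent line the adapted equation `flex_equation` reduces to (x - x₀)³ = 0, so the only
affine intersection is the flex itself. -/
lemma tangentVal_eq_zero_iff {P X : W.Point} (h3 : (3 : ℤ) • P = 0) (hX : X ≠ 0) :
    tangentVal P X = 0 ↔ X = P := by
  rcases X with _ | ⟨x, y, h'⟩
  · exact absurd rfl hX
  rcases P with _ | ⟨x₀, y₀, h⟩
  · exact ⟨fun e => absurd e one_ne_zero, fun e => absurd e hX⟩
  constructor
  · intro e
    have e' := flex_equation h3 h'.1
    rw [tangentVal_some] at e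
    rw [e] at e'
    have hu : x - x₀ = 0 := by
      apply pow_eq_zero_iff (n := 3) (by norm_num) |>.mp
      rw [← e']
      ring
    rw [tangentForm_some, hu] at e
    simp only [Affine.Point.some.injEq]
    exact ⟨by linear_combination hu, by linear_combination e⟩
  · intro e
    simp only [Affine.Point.some.injEq] at e
    obtain ⟨rfl, rfl⟩ := e
    simp

/-- Translation by a flex is linear in adapted coordinates. -/
lemma add_flex {x₀ y₀ : F} {h : W.Nonsingular x₀ y₀}
    (h3 : (3 : ℤ) • Affine.Point.some x₀ y₀ h = 0) {x y : F} (hX : W.Nonsingular x y)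
    (hne : Affine.Point.some x y hX ≠ -Affine.Point.some x₀ y₀ h) :
    ∃ (x' y' : F) (h' : W.Nonsingular x' y'),
      Affine.Point.some x y hX + Affine.Point.some x₀ y₀ h = .some x' y' h' ∧
      (x' - x₀) * tangentForm (-Affine.Point.some x₀ y₀ h) x y =
        -(2 * y₀ + W.a₁ * x₀ + W.a₃) * (x - x₀) ∧
      tangentForm (-Affine.Point.some x₀ y₀ h) x' y' *
        tangentForm (-Affine.Point.some x₀ y₀ h) x y =
        (2 * y₀ + W.a₁ * x₀ + W.a₃) * tangentForm (.some x₀ y₀ h) x y := by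
  by_cases hx : x = x₀
  · have hXQ := (Affine.Point.X_eq_iff (h₁ := hX) (h₂ := h)).mp hx
    have hXQ := hXQ.resolve_right hne
    rw [hXQ]
    simp only [Affine.Point.some.injEq] at hXQ
    obtain ⟨rfl, rfl⟩ := hXQ
    refine ⟨_, _, (Affine.nonsingular_neg x y).mpr h, add_self_of_three_zsmul h3, ?_, ?_⟩
    · simp
    · simp
  · rw [Affine.Point.add_of_X_ne hx]
    have hu : x - x₀ ≠ 0 := sub_ne_zero.mpr hx
    refine ⟨_, _, _, rfl, ?_⟩
    have hs := Affine.slope_of_X_ne (W := W) (y₁ := y) (y₂ := y₀) hx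
    generalize W.slope x x₀ y y₀ = L at hs ⊢
    have hy : y = y₀ + L * (x - x₀) := by
      rw [hs]; field_simp; ring
    have e := flex_equation h3 hX.1
    have e2 := three_mul_x_flex h3
    rw [tangentForm_neg h3, tangentForm_neg h3]
    simp only [tangentForm_some, Affine.addX, Affine.addY, Affine.negAddY, Affine.negY] at e ⊢
    generalize W.slope x₀ x₀ y₀ y₀ = l at e e2 ⊢
    obtain ⟨u, hxu⟩ : ∃ u, u = x - x₀ := ⟨_, rfl⟩
    rw [← hxu] at hu hy e ⊢
    obtain rfl : x = x₀ + u := by rw [hxu]; ring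
    subst hy
    -- m is the chord slope relative to the tangent at the flex, so the tangent form takes the value
    -- m * u and the adapted equation can be divided by u.
    obtain ⟨m, hm⟩ : ∃ m, L = l + m := ⟨L - l, by ring⟩
    subst hm
    have e' : m * (m + (W.a₁ + 2 * l)) * u + (2 * y₀ + W.a₁ * x₀ + W.a₃) * m = u ^ 2 := by
      apply mul_left_cancel₀ hu
      linear_combination e
    obtain ⟨a₂, h2⟩ : ∃ a₂, W.a₂ = a₂ := ⟨_, rfl⟩
    rw [h2] at e2 ⊢
    obtain rfl : a₂ = l ^ 2 + W.a₁ * l - 3 * x₀ := by linear_combination e2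
    constructor
    · linear_combination (m + (W.a₁ + 2 * l)) * e'
    · linear_combination -m * (m + (W.a₁ + 2 * l)) * e'

end Flex

/-! ### Translation of tangent forms by 3-torsion points -/

section FlexTranslation

open WeierstrassCurve

variable {F : Type*} [Field F] [DecidableEq F] {W : WeierstrassCurve.Affine F}

omit [DecidableEq F] in
lemma exists_quadratic_root [IsAlgClosed F] [CharZero F] (p q : F) :
    ∃ t : F, t ^ 2 + p * t + q = 0 := by
  obtain ⟨s, hs⟩ := IsAlgClosed.exists_eq_mul_self (discrim 1 p q)
  obtain ⟨t, ht⟩ := exists_quadratic_eq_zero one_ne_zero ⟨s, hs⟩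
  exact ⟨t, by linear_combination ht⟩

/-- An affine form whose only zero on the curve is the flex `R` is proportional to the tangent form
at `R`. -/
lemma affineForm_eq_tangentForm [IsAlgClosed F] [CharZero F] [W.IsElliptic] {R : W.Point}
    (hR : R ≠ 0) (h3 : (3 : ℤ) • R = 0) {a b c : F}
    (hg : ∀ (x y : F) (h : W.Nonsingular x y), a * x + b * y + c = 0 ↔ .some x y h = R) (x y : F) :
    a * x + b * y + c = b * tangentForm R x y := by
  rcases R with _ | ⟨x₀, y₀, h⟩
  · exact absurd rfl hR
  have h0 : a * x₀ + b * y₀ + c = 0 := (hg x₀ y₀ h).mpr rfl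
  have hd := two_mul_y_ne_zero_flex h3
  -- With b = 0 the line would be vertical and would also contain -R, which differs from R.
  have hb : b ≠ 0 := by
    rintro rfl
    have := (hg x₀ _ ((Affine.nonsingular_neg x₀ y₀).mpr h)).mp (by linear_combination h0)
    rw [Affine.Point.some.injEq] at this
    exact flex_ne h3 this.2.symm
  suffices hβ : a + b * W.slope x₀ x₀ y₀ y₀ = 0 by
    rw [tangentForm_some]
    linear_combination h0 + (x - x₀) * hβ
  -- s is the slope of the line relative to the tangent. Putting v = s * u in the adapted equation
  -- and dividing by u leaves a quadratic with constant term -d * s, where d = 2y₀ + a₁x₀ + a₃. Any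
  -- root u gives a zero of the form, hence u = 0 and s = 0.
  obtain ⟨s, hs⟩ : ∃ s, a + b * W.slope x₀ x₀ y₀ y₀ = -b * s :=
    ⟨(a + b * W.slope x₀ x₀ y₀ y₀) / (-b), by field_simp⟩
  obtain ⟨u, hu⟩ := exists_quadratic_root
    (-(s ^ 2 + (W.a₁ + 2 * W.slope x₀ x₀ y₀ y₀) * s)) (-((2 * y₀ + W.a₁ * x₀ + W.a₃) * s))
  have heq := equation_of_flex_equation h3 (u := u) (v := s * u) (by linear_combination -u * hu)
  have := (hg _ _ (Affine.equation_iff_nonsingular.mp heq)).mp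
    (by linear_combination h0 + u * hs)
  rw [Affine.Point.some.injEq] at this
  obtain rfl : u = 0 := by linear_combination this.1
  have hs0 : s = 0 := by
    apply (mul_eq_zero.mp _).resolve_left hd
    linear_combination -hu
  rw [hs, hs0, mul_zero]

omit [DecidableEq F] in
lemma infinite_point [IsAlgClosed F] [CharZero F] [W.IsElliptic] : Infinite W.Point := by
  have hex (x : F) : ∃ y, W.Nonsingular x y := by
    obtain ⟨y, hy⟩ := exists_quadratic_root (W.a₁ * x + W.a₃)
      (-(x ^ 3 + W.a₂ * x ^ 2 + W.a₄ * x + W.a₆))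
    refine ⟨y, Affine.equation_iff_nonsingular.mp ((Affine.equation_iff _ _).mpr ?_)⟩
    linear_combination hy
  choose y hy using hex
  refine Infinite.of_injective (fun x => Affine.Point.some x (y x) (hy x)) fun x x' h => ?_
  simp only [Affine.Point.some.injEq] at h
  exact h.1

omit [DecidableEq F] in
lemma neg_eq_some {x₀ y₀ x y : F} {h : W.Nonsingular x₀ y₀} {h' : W.Nonsingular x y}
    (e : -Affine.Point.some x₀ y₀ h = .some x y h') : x = x₀ ∧ y = W.negY x₀ y₀ := by
  rw [Affine.Point.neg_some, Affine.Point.some.injEq] at e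
  exact ⟨e.1.symm, e.2.symm⟩

/-- Translating the tangent form at `-Q` by `Q`. -/
lemma tangentVal_neg_add {Q : W.Point} (hQ : Q ≠ 0) (h3 : (3 : ℤ) • Q = 0) :
    ∃ d : F, d ≠ 0 ∧ tangentVal (-Q) Q = d ∧ tangentVal Q (-Q) = -d ∧
      ∀ X : W.Point, X ≠ 0 → X ≠ -Q →
        tangentVal (-Q) (X + Q) * tangentVal (-Q) X = d * tangentVal Q X := by
  rcases Q with _ | ⟨x₀, y₀, h⟩
  · exact absurd rfl hQ
  refine ⟨2 * y₀ + W.a₁ * x₀ + W.a₃, two_mul_y_ne_zero_flex h3, ?_, ?_, fun X hX hXQ => ?_⟩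
  · rw [tangentVal_some, tangentForm_neg h3, tangentForm_some]
    ring
  · rw [Affine.Point.neg_some, tangentVal_some, tangentForm_some]
    simp only [Affine.negY]
    ring
  · rcases X with _ | ⟨x, y, hX'⟩
    · exact absurd rfl hX
    obtain ⟨x', y', h', e, -, e'⟩ := add_flex h3 hX' hXQ
    rw [e]
    exact e'

/-- Translating the tangent form at `Q` by `Q`. -/
lemma tangentVal_add_self {Q : W.Point} (hQ : Q ≠ 0) (h3 : (3 : ℤ) • Q = 0) :
    ∃ c : F, c ≠ 0 ∧ ∀ X : W.Point, X ≠ 0 → X ≠ -Q →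
      tangentVal Q (X + Q) * tangentVal (-Q) X = c := by
  obtain ⟨d, hd, hd1, hd2, hd3⟩ := tangentVal_neg_add hQ h3
  obtain ⟨d', hd', hd1', hd2', hd3'⟩ := tangentVal_neg_add (neg_ne_zero.mpr hQ) (three_zsmul_neg h3)
  rw [neg_neg] at hd1' hd2' hd3'
  have hdd : d' = -d := by rw [← hd2, hd1']
  subst hdd
  refine ⟨-d * d, mul_ne_zero hd' hd, fun X hX hXQ => ?_⟩
  -- At X = Q the factor `tangentVal Q X`, cancelled below, vanishes. Elsewhere, combining the
  -- translation by Q at X with the translation by -Q at X + Q gives c = -d².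
  by_cases hXQ' : X = Q
  · rw [hXQ', add_self_of_three_zsmul h3, hd2, hd1]
  have h1 := hd3' (X + Q) (fun h => hXQ (eq_neg_of_add_eq_zero_left h)) (by simpa using hX)
  rw [add_neg_cancel_right] at h1
  have h0 : tangentVal Q X ≠ 0 := fun h => hXQ' ((tangentVal_eq_zero_iff h3 hX).mp h)
  apply mul_left_cancel₀ h0
  linear_combination tangentVal (-Q) X * h1 - d * hd3 X hX hXQ

/-- Translating the tangent form at `P` by `Q`, in general position. -/
lemma tangentVal_add_of_ne [IsAlgClosed F] [CharZero F] [W.IsElliptic] {P Q : W.Point}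
    (hP : P ≠ 0) (hQ : Q ≠ 0) (hPQ : P ≠ Q) (h3P : (3 : ℤ) • P = 0) (h3Q : (3 : ℤ) • Q = 0)
    {X : W.Point} (hX : X ≠ 0) (hXQ : X ≠ -Q) :
    tangentVal P (X + Q) * tangentVal (-Q) X = tangentVal P Q * tangentVal (P - Q) X := by
  rcases Q with _ | ⟨x₀, y₀, h⟩
  · exact absurd rfl hQ
  obtain ⟨x₁, y₁, h₁, rfl⟩ : ∃ x₁ y₁ h₁, P = .some x₁ y₁ h₁ := by
    rcases P with _ | ⟨x₁, y₁, h₁⟩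
    · exact absurd rfl hP
    · exact ⟨_, _, _, rfl⟩
  have hd := two_mul_y_ne_zero_flex h3Q
  set P := Affine.Point.some x₁ y₁ h₁ with hPdef
  set Q := Affine.Point.some x₀ y₀ h with hQdef
  set d := 2 * y₀ + W.a₁ * x₀ + W.a₃ with hddef
  set l := W.slope x₀ x₀ y₀ y₀ with hldef
  set k := W.slope x₁ x₁ y₁ y₁ with hkdef
  -- the form at `P` in coordinates adapted to `-Q`
  obtain ⟨α, β, hαβ⟩ : ∃ α β : F, ∀ x y, tangentForm P x y =
      α + β * (x - x₀) + tangentForm (-Q) x y := by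
    refine ⟨y₀ - y₁ - k * (x₀ - x₁) - d, -k + l - (W.a₁ + 2 * l), fun x y => ?_⟩
    rw [hQdef, tangentForm_neg h3Q, tangentForm_some, tangentForm_some]
    ring
  have hval : tangentVal P Q = α + d := by
    rw [hQdef, tangentVal_some, hαβ, hQdef, tangentForm_neg h3Q, tangentForm_some]
    ring
  -- Translation by Q is projective linear with denominator the form at -Q; clearing it turns the
  -- translated form into an affine form, to be identified by its unique zero P - Q.
  have key (x y : F) (hX : W.Nonsingular x y) (hne : Affine.Point.some x y hX ≠ -Q) :
      tangentVal P (.some x y hX + Q) * tangentForm (-Q) x y =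
        α * tangentForm (-Q) x y - β * d * (x - x₀) + d * tangentForm Q x y := by
    obtain ⟨x', y', h', e, e1, e2⟩ := add_flex h3Q hX hne
    rw [← hQdef] at e e1 e2
    rw [e, tangentVal_some, hαβ]
    linear_combination β * e1 + e2
  have h3R : (3 : ℤ) • (P - Q) = 0 := by rw [smul_sub, h3P, h3Q, sub_zero]
  have hform (x y : F) : α * tangentForm (-Q) x y - β * d * (x - x₀) + d * tangentForm Q x y =
      (α * (l + W.a₁) - β * d - d * l) * x + (α + d) * y +
        (α * (y₀ + W.a₁ * x₀ + W.a₃ - (l + W.a₁) * x₀) + β * d * x₀ - d * (y₀ - l * x₀)) := by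
    rw [hQdef, tangentForm_neg h3Q, tangentForm_some]
    ring
  have hzero (x y : F) (hX : W.Nonsingular x y) :
      (α * (l + W.a₁) - β * d - d * l) * x + (α + d) * y +
        (α * (y₀ + W.a₁ * x₀ + W.a₃ - (l + W.a₁) * x₀) + β * d * x₀ - d * (y₀ - l * x₀)) = 0 ↔
      Affine.Point.some x y hX = P - Q := by
    rw [← hform]
    -- At -Q the translate is the point at infinity and `key` does not apply, but the affine form
    -- takes the nonzero value -d² there.
    by_cases hne : Affine.Point.some x y hX = -Q
    · constructor
      · intro e
        obtain ⟨rfl, rfl⟩ := neg_eq_some (hne.symm.trans rfl)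
        have z : tangentForm (-Q) x (W.negY x y₀) = 0 := by
          rw [← tangentVal_some _ hX, tangentVal_eq_zero_iff (three_zsmul_neg h3Q)
            (Affine.Point.some_ne_zero hX)]
          exact hne
        rw [z, hQdef, tangentForm_some] at e
        exfalso
        apply mul_ne_zero hd hd
        simp only [Affine.negY] at e
        linear_combination -e
      · intro e
        exfalso
        rw [hne, eq_comm, sub_eq_iff_eq_add, neg_add_cancel] at e
        exact hP e
    · rw [← key x y hX hne, mul_eq_zero, ← tangentVal_some (-Q) hX,
        tangentVal_eq_zero_iff (three_zsmul_neg h3Q) (Affine.Point.some_ne_zero hX),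
        or_iff_left hne, tangentVal_eq_zero_iff h3P
          (fun h => hne (eq_neg_of_add_eq_zero_left h)), eq_sub_iff_add_eq]
  rcases X with _ | ⟨x, y, hX'⟩
  · exact absurd rfl hX
  rw [tangentVal_some, key x y hX' hXQ, hform,
    affineForm_eq_tangentForm (sub_ne_zero.mpr hPQ) h3R hzero, hval, tangentVal_some]

/-- Translation by a `3`-torsion point carries tangent forms at flexes to ratios of such forms. -/
lemma tangentVal_add [IsAlgClosed F] [CharZero F] [W.IsElliptic] {P Q : W.Point}
    (h3P : (3 : ℤ) • P = 0) (h3Q : (3 : ℤ) • Q = 0) :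
    ∃ c : F, c ≠ 0 ∧ ∀ X : W.Point, X ≠ 0 → X ≠ -Q →
      tangentVal P (X + Q) * tangentVal (-Q) X = c * tangentVal (P - Q) X := by
  by_cases hQ : Q = 0
  · subst hQ
    refine ⟨1, one_ne_zero, fun X hX _ => ?_⟩
    rw [_root_.neg_zero, tangentVal_zero_left hX, add_zero, sub_zero, mul_one, one_mul]
  by_cases hP : P = 0
  · subst hP
    refine ⟨1, one_ne_zero, fun X hX hXQ => ?_⟩
    rw [tangentVal_zero_left (fun h => hXQ (eq_neg_of_add_eq_zero_left h)), zero_sub]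
  by_cases hPQ : P = Q
  · subst hPQ
    obtain ⟨c, hc, h⟩ := tangentVal_add_self hP h3P
    refine ⟨c, hc, fun X hX hXQ => ?_⟩
    rw [h X hX hXQ, sub_self, tangentVal_zero_left hX, mul_one]
  · exact ⟨_, fun h => hPQ ((tangentVal_eq_zero_iff h3P hQ).mp h).symm,
      fun X hX hXQ => tangentVal_add_of_ne hP hQ hPQ h3P h3Q hX hXQ⟩

end FlexTranslation

/-! ### The Weil pairing of flexes through tangent forms -/

section WeilValue

open WeierstrassCurve Polynomial

variable {F : Type*} [Field F] {W : WeierstrassCurve.Affine F}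

/-- The units of the affine coordinate ring of a Weierstrass cubic are the nonzero constants. -/
lemma exists_const_of_isUnit {f : W.CoordinateRing} (hf : IsUnit f) :
    ∃ c : F, c ≠ 0 ∧ f = Affine.CoordinateRing.mk W (C (C c)) := by
  obtain ⟨p, q, rfl⟩ := Affine.CoordinateRing.exists_smul_basis_eq f
  have hn := hf.map (Algebra.norm F[X])
  have hdeg := degree_eq_zero_of_isUnit hn
  -- The norm of p + qY has degree max(2 deg p, 2 deg q + 3); degree 0 forces q = 0 and p constant.
  rw [Affine.CoordinateRing.degree_norm_smul_basis] at hdeg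
  have hq : q = 0 := by
    by_contra hq
    have h1 := le_max_right (2 • p.degree) (2 • q.degree + 3)
    rw [hdeg, degree_eq_natDegree hq] at h1
    have h2 : ((2 * q.natDegree + 3 : ℕ) : WithBot ℕ) ≤ (0 : ℕ) := by
      refine le_trans (le_of_eq ?_) h1
      simp
    have := WithBot.coe_le_coe.mp h2
    simp at this
  subst hq
  have hp0 : p ≠ 0 := by
    rintro rfl
    simp at hf
  have hp : p.natDegree = 0 := by
    have h1 := le_max_left (2 • p.degree) (2 • (0 : F[X]).degree + 3)
    rw [hdeg, degree_eq_natDegree hp0] at h1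
    have h2 : ((2 * p.natDegree : ℕ) : WithBot ℕ) ≤ (0 : ℕ) := by
      refine le_trans (le_of_eq ?_) h1
      simp
    have := WithBot.coe_le_coe.mp h2
    simpa using this
  obtain ⟨c, rfl⟩ := natDegree_eq_zero.mp hp
  refine ⟨c, fun h => hp0 (by rw [h, C_0]), ?_⟩
  rw [Affine.CoordinateRing.smul, zero_smul, add_zero, mul_one]

variable [DecidableEq F]

/-- The tangent form at `P` as an element of the affine coordinate ring. -/
def tangentClass : W.Point → W.CoordinateRing
  | .zero => 1
  | .some x₀ y₀ _ => Affine.CoordinateRing.YClass W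
      (Affine.linePolynomial x₀ y₀ (W.slope x₀ x₀ y₀ y₀))

lemma evalAt_tangentClass (P X : W.Point) : evalAt W (tangentClass P) X = tangentVal P X := by
  rcases X with _ | ⟨x, y, h⟩
  · rfl
  rcases P with _ | ⟨x₀, y₀, h₀⟩
  · change AdjoinRoot.evalEval h.1 1 = 1
    exact map_one _
  · change AdjoinRoot.evalEval h.1 (AdjoinRoot.mk _ _) = y - y₀ - _ * (x - x₀)
    refine (AdjoinRoot.evalEval_mk h.1 _).trans ?_
    simp only [Affine.linePolynomial, evalEval_sub, evalEval_X, evalEval_C, eval_add, eval_mul,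
      eval_C, eval_sub, eval_X]
    ring

/-- The tangent meets the curve twice at P and once at -2P = P. In ideals, the addition relation for
2P = -P is multiplied by the ideal of P, and the vertical line through P and -P is then cancelled.
-/
lemma span_tangentClass {P : W.Point} (h3 : (3 : ℤ) • P = 0) :
    Ideal.span {tangentClass P} = pointIdeal W P ^ 3 := by
  rcases P with _ | ⟨x₀, y₀, h⟩
  · change Ideal.span {(1 : W.CoordinateRing)} = ⊤ ^ 3
    rw [Ideal.span_singleton_one, Ideal.top_pow]
  have hy := flex_ne h3
  have hadd := add_self_of_three_zsmul h3
  rw [Affine.Point.add_self_of_Y_ne hy, Affine.Point.neg_some, Affine.Point.some.injEq] at hadd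
  have key := Affine.CoordinateRing.XYIdeal_mul_XYIdeal h.1 h.1 (fun h => hy h.2)
  rw [hadd.1, hadd.2] at key
  have hneg := Affine.CoordinateRing.XYIdeal_neg_mul h
  change Affine.CoordinateRing.YIdeal W _ = Affine.CoordinateRing.XYIdeal W x₀ (C y₀) ^ 3
  have hX : Affine.CoordinateRing.XIdeal W x₀ ≠ 0 := by
    rw [Affine.CoordinateRing.XIdeal, Ne, Ideal.zero_eq_bot, Ideal.span_singleton_eq_bot]
    exact Affine.CoordinateRing.XClass_ne_zero x₀
  have key' : Affine.CoordinateRing.XIdeal W x₀ * Affine.CoordinateRing.YIdeal W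
        (Affine.linePolynomial x₀ y₀ (W.slope x₀ x₀ y₀ y₀)) =
      Affine.CoordinateRing.XIdeal W x₀ * Affine.CoordinateRing.XYIdeal W x₀ (C y₀) ^ 3 := by
    rw [pow_succ, pow_two, ← mul_assoc, key, mul_assoc, hneg, mul_comm]
  rw [Affine.CoordinateRing.XIdeal] at key' hX
  exact (Ideal.span_singleton_mul_right_inj (Affine.CoordinateRing.XClass_ne_zero x₀)).mp key'

/-- Every generator of the cube of the ideal of a flex is a multiple of the tangent form. -/
lemma exists_evalAt_eq {P : W.Point} (h3 : (3 : ℤ) • P = 0) {f : W.CoordinateRing}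
    (hf : Ideal.span {f} = pointIdeal W P ^ 3) :
    ∃ c : F, c ≠ 0 ∧ ∀ X, evalAt W f X = c * tangentVal P X := by
  rw [← span_tangentClass h3, Ideal.span_singleton_eq_span_singleton] at hf
  obtain ⟨u, hu⟩ := hf.symm
  obtain ⟨c, hc, hcu⟩ := exists_const_of_isUnit u.isUnit
  refine ⟨c, hc, fun X => ?_⟩
  rw [← evalAt_tangentClass, ← hu, hcu]
  rcases X with _ | ⟨x, y, h⟩
  · exact (mul_zero c).symm
  · change AdjoinRoot.evalEval h.1 _ = _ * AdjoinRoot.evalEval h.1 _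
    rw [map_mul, mul_comm]
    congr 1
    exact (AdjoinRoot.evalEval_mk h.1 _).trans (evalEval_CC x y c)

/-- The expression defining the Weil pairing of two flexes, in terms of tangent forms. -/
def weilRatio (P Q X : W.Point) : F :=
  (tangentVal P (Q + X) / tangentVal P X) / (tangentVal Q (P - X) / tangentVal Q (-X))

/-- The functions `f` and `g` are unique up to constants, and these cancel because each occurs only
as a ratio of two values. -/
lemma isWeilValue_three_iff {P Q : W.Point} (h3P : (3 : ℤ) • P = 0) (h3Q : (3 : ℤ) • Q = 0)
    {z : F} : IsWeilValue W 3 P Q z ↔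
      ∃ X, X ≠ 0 ∧ X ≠ P ∧ X ≠ -Q ∧ X ≠ P - Q ∧ z = weilRatio P Q X := by
  constructor
  · rintro ⟨f, g, X, hf, hg, h1, h2, h4, h5, rfl⟩
    refine ⟨X, h1, h2, h4, h5, ?_⟩
    obtain ⟨c, hc, hf⟩ := exists_evalAt_eq h3P hf
    obtain ⟨d, hd, hg⟩ := exists_evalAt_eq h3Q hg
    rw [hf, hf, hg, hg, mul_div_mul_left _ _ hc, mul_div_mul_left _ _ hd, weilRatio]
  · rintro ⟨X, h1, h2, h4, h5, rfl⟩
    refine ⟨_, _, X, span_tangentClass h3P, span_tangentClass h3Q, h1, h2, h4, h5, ?_⟩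
    simp only [evalAt_tangentClass, weilRatio]

variable [IsAlgClosed F] [CharZero F] [W.IsElliptic]

/-- Translating t_P by Q and t_{-Q} by -P produces the same form t_{P-Q}; every factor depending on
X cancels, leaving the ratio of the translation constants. -/
lemma exists_weilRatio_eq {P Q : W.Point} (h3P : (3 : ℤ) • P = 0) (h3Q : (3 : ℤ) • Q = 0) :
    ∃ w : F, ∀ X : W.Point, X ≠ 0 → X ≠ P → X ≠ -Q → X ≠ P - Q → weilRatio P Q X = w := by
  obtain ⟨c, hc, h⟩ := tangentVal_add h3P h3Q
  obtain ⟨c', hc', h'⟩ := tangentVal_add (three_zsmul_neg h3Q) (three_zsmul_neg h3P)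
  refine ⟨c / c', fun X h0 hP hQ hPQ => ?_⟩
  have e := h X h0 hQ
  have e' := h' X h0 (by rwa [neg_neg])
  rw [neg_neg, sub_neg_eq_add, neg_add_eq_sub] at e'
  have z1 : tangentVal (-Q) X ≠ 0 := by rwa [Ne, tangentVal_eq_zero_iff (three_zsmul_neg h3Q) h0]
  have z2 : tangentVal P X ≠ 0 := by rwa [Ne, tangentVal_eq_zero_iff h3P h0]
  have z3 : tangentVal (P - Q) X ≠ 0 := by
    rwa [Ne, tangentVal_eq_zero_iff (by rw [smul_sub, h3P, h3Q, sub_zero]) h0]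
  have zs := tangentSign_ne_zero Q
  rw [weilRatio, ← neg_sub X P, tangentVal_neg h3Q, tangentVal_neg h3Q, mul_div_mul_left _ _ zs,
    add_comm Q X, sub_eq_add_neg, eq_div_of_mul_eq z1 e, eq_div_of_mul_eq z2 e']
  field_simp

/-- All admissible auxiliary points give the same value, so the choice made by `Classical.epsilon`
is immaterial. -/
lemma weilPairing_eq {P Q : W.Point} (h3P : (3 : ℤ) • P = 0) (h3Q : (3 : ℤ) • Q = 0)
    {X : W.Point} (h0 : X ≠ 0) (hP : X ≠ P) (hQ : X ≠ -Q) (hPQ : X ≠ P - Q) :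
    weilPairing W 3 P Q = weilRatio P Q X := by
  have hex : ∃ z, IsWeilValue W 3 P Q z :=
    ⟨_, (isWeilValue_three_iff h3P h3Q).mpr ⟨X, h0, hP, hQ, hPQ, rfl⟩⟩
  have := Classical.epsilon_spec hex
  obtain ⟨Y, h0', hP', hQ', hPQ', e⟩ := (isWeilValue_three_iff h3P h3Q).mp this
  obtain ⟨w, hw⟩ := exists_weilRatio_eq h3P h3Q
  rw [weilPairing, e, hw X h0 hP hQ hPQ, hw Y h0' hP' hQ' hPQ']

omit [DecidableEq F] in
lemma exists_point_notMem (s : Finset W.Point) : ∃ X : W.Point, X ∉ s :=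
  haveI := infinite_point (W := W)
  Infinite.exists_notMem_finset s

/-- With auxiliary point X for (P, R) and X + R for (P, Q), the t_P factors telescope; translating
t_Q by -R combines the remaining factors into those of t_{Q+R}. -/
lemma weilPairing_add_right {P Q R : W.Point} (hP : (3 : ℤ) • P = 0) (hQ : (3 : ℤ) • Q = 0)
    (hR : (3 : ℤ) • R = 0) :
    weilPairing W 3 P (Q + R) = weilPairing W 3 P Q * weilPairing W 3 P R := by
  obtain ⟨X, hX⟩ := exists_point_notMem ({0, P, -(Q + R), P - (Q + R), -R, P - R} : Finset W.Point)
  simp only [Finset.mem_insert, Finset.mem_singleton, not_or] at hX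
  obtain ⟨h1, h2, h3, h4, h5, h6⟩ := hX
  have i1 : X + R ≠ 0 := fun h => h5 (eq_neg_of_add_eq_zero_left h)
  have i2 : X + R ≠ P := fun h => h6 (eq_sub_of_add_eq h)
  have i3 : X + R ≠ -Q := fun h => h3 (by rw [neg_add, ← h]; abel)
  have i4 : X + R ≠ P - Q := fun h => h4 (by rw [← sub_sub, ← h]; abel)
  rw [weilPairing_eq hP (by rw [smul_add, hQ, hR, add_zero]) h1 h2 h3 h4,
    weilPairing_eq hP hR h1 h2 h5 h6, weilPairing_eq hP hQ i1 i2 i3 i4]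
  simp only [weilRatio]
  obtain ⟨c, hc, h⟩ := tangentVal_add hQ (three_zsmul_neg hR)
  have e1 := h (-X) (neg_ne_zero.mpr h1) (by simpa [neg_eq_iff_eq_neg] using h5)
  have e2 := h (P - X) (sub_ne_zero.mpr (Ne.symm h2)) (by
    rw [neg_neg]; intro e; exact h6 (by rw [← e]; abel))
  rw [neg_neg, sub_neg_eq_add] at e1 e2
  have j1 : tangentVal P (X + R) ≠ 0 := by rwa [Ne, tangentVal_eq_zero_iff hP i1]
  have j2 : tangentVal R (-X) ≠ 0 := by
    rw [Ne, tangentVal_eq_zero_iff hR (neg_ne_zero.mpr h1), neg_eq_iff_eq_neg]; exact h5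
  have j3 : tangentVal R (P - X) ≠ 0 := by
    rw [Ne, tangentVal_eq_zero_iff hR (sub_ne_zero.mpr (Ne.symm h2))]
    intro e; exact h6 (by rw [← e]; abel)
  rw [show Q + (X + R) = Q + R + X by abel, show P - (X + R) = P - X + -R by abel,
    show -(X + R) = -X + -R by abel, add_comm R X, eq_div_of_mul_eq j2 e1, eq_div_of_mul_eq j3 e2]
  field_simp

/-- Exchanging P and Q and replacing X by -X visibly inverts the defining ratio. -/
lemma weilPairing_swap {P Q : W.Point} (hP : (3 : ℤ) • P = 0) (hQ : (3 : ℤ) • Q = 0) :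
    weilPairing W 3 Q P = (weilPairing W 3 P Q)⁻¹ := by
  obtain ⟨X, hX⟩ := exists_point_notMem ({0, P, -Q, P - Q} : Finset W.Point)
  simp only [Finset.mem_insert, Finset.mem_singleton, not_or] at hX
  obtain ⟨h1, h2, h3, h4⟩ := hX
  rw [weilPairing_eq hP hQ h1 h2 h3 h4, weilPairing_eq hQ hP (neg_ne_zero.mpr h1)
    (by simpa [neg_eq_iff_eq_neg] using h3) (by simpa using h2)
    (fun e => h4 (by rw [← neg_sub, ← e, neg_neg])), weilRatio, weilRatio, inv_div, neg_neg,
    sub_neg_eq_add, sub_eq_add_neg]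

lemma weilPairing_ne_zero {P Q : W.Point} (hP : (3 : ℤ) • P = 0) (hQ : (3 : ℤ) • Q = 0) :
    weilPairing W 3 P Q ≠ 0 := by
  obtain ⟨X, hX⟩ := exists_point_notMem ({0, P, -Q, P - Q} : Finset W.Point)
  simp only [Finset.mem_insert, Finset.mem_singleton, not_or] at hX
  obtain ⟨h1, h2, h3, h4⟩ := hX
  rw [weilPairing_eq hP hQ h1 h2 h3 h4, weilRatio]
  have k1 : Q + X ≠ 0 := fun h => h3 (eq_neg_of_add_eq_zero_right h)
  have k2 : P - X ≠ 0 := sub_ne_zero.mpr (Ne.symm h2)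
  refine div_ne_zero (div_ne_zero ?_ ?_) (div_ne_zero ?_ ?_)
  · rw [Ne, tangentVal_eq_zero_iff hP k1]
    exact fun h => h4 (by rw [← h]; abel)
  · rwa [Ne, tangentVal_eq_zero_iff hP h1]
  · rw [Ne, tangentVal_eq_zero_iff hQ k2]
    exact fun h => h4 (by rw [← h]; abel)
  · rw [Ne, tangentVal_eq_zero_iff hQ (neg_ne_zero.mpr h1), neg_eq_iff_eq_neg]
    exact h3

/-- The product t_P(X + P) t_{-P}(X) is constant; comparing it at X and -X gives equal numerator and
denominator, the two signs cancelling. -/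
lemma weilPairing_self {P : W.Point} (hP : (3 : ℤ) • P = 0) : weilPairing W 3 P P = 1 := by
  obtain ⟨X, hX⟩ := exists_point_notMem ({0, P, -P} : Finset W.Point)
  simp only [Finset.mem_insert, Finset.mem_singleton, not_or] at hX
  obtain ⟨h1, h2, h3⟩ := hX
  have hv : tangentVal P X ≠ 0 := by rwa [Ne, tangentVal_eq_zero_iff hP h1]
  have h1' : -X ≠ 0 := neg_ne_zero.mpr h1
  rw [weilPairing_eq hP hP h1 h2 h3 (by rwa [sub_self]), weilRatio]
  obtain ⟨c, hc, h⟩ := tangentVal_add hP hP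
  have e1 := h X h1 h3
  have e2 := h (-X) h1' (by simpa using h2)
  rw [sub_self, tangentVal_zero_left h1, mul_one] at e1
  rw [sub_self, tangentVal_zero_left h1', mul_one, tangentVal_neg (three_zsmul_neg hP), neg_neg,
    tangentSign_neg] at e2
  have hs := tangentSign_ne_zero P
  have n2 : tangentVal (-P) X ≠ 0 := fun h => hc (by rw [← e1, h, mul_zero])
  have n3 : tangentVal P (P - X) ≠ 0 := fun h => hc (by
    rw [← e2, neg_add_eq_sub, h, zero_mul])
  rw [tangentVal_neg hP X, add_comm P X]
  rw [neg_add_eq_sub] at e2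
  field_simp
  linear_combination tangentSign P * e1 - tangentSign P * e2 +
    tangentVal P (P - X) * tangentVal P X * tangentSign_mul_self P

/-- The Weil pairing of two independent `3`-torsion points is nontrivial. -/
lemma weilPairing_ne_one {P Q : W.Point} (hP : (3 : ℤ) • P = 0) (hQ : (3 : ℤ) • Q = 0)
    (hP0 : P ≠ 0) (hQ0 : Q ≠ 0) (h : P ≠ Q) (h' : P ≠ -Q) : weilPairing W 3 P Q ≠ 1 := by
  obtain ⟨X, hX⟩ := exists_point_notMem ({0, P, -Q, P - Q} : Finset W.Point)
  simp only [Finset.mem_insert, Finset.mem_singleton, not_or] at hX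
  obtain ⟨h1, h2, h3, h4⟩ := hX
  rw [weilPairing_eq hP hQ h1 h2 h3 h4]
  have e := tangentVal_add_of_ne hP0 hQ0 h hP hQ h1 h3
  have e' := tangentVal_add_of_ne (neg_ne_zero.mpr hQ0) (neg_ne_zero.mpr hP0)
    (fun h' => h (neg_inj.mp h').symm) (three_zsmul_neg hQ) (three_zsmul_neg hP) h1
    (by rwa [neg_neg])
  rw [neg_neg, sub_neg_eq_add, neg_add_eq_sub, ← sub_eq_add_neg] at e'
  have z1 : tangentVal (-Q) X ≠ 0 := by rwa [Ne, tangentVal_eq_zero_iff (three_zsmul_neg hQ) h1]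
  have z2 : tangentVal P X ≠ 0 := by rwa [Ne, tangentVal_eq_zero_iff hP h1]
  have z3 : tangentVal (P - Q) X ≠ 0 := by
    rwa [Ne, tangentVal_eq_zero_iff (by rw [smul_sub, hP, hQ, sub_zero]) h1]
  have z4 : tangentVal (-Q) (X - P) ≠ 0 := by
    rw [Ne, tangentVal_eq_zero_iff (three_zsmul_neg hQ) (sub_ne_zero.mpr h2)]
    exact fun h => h4 (by rw [sub_eq_iff_eq_add.mp h]; abel)
  have zs := tangentSign_ne_zero Q
  intro heq
  rw [weilRatio, ← neg_sub X P, tangentVal_neg hQ, tangentVal_neg hQ, mul_div_mul_left _ _ zs,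
    add_comm Q X] at heq
  -- If the pairing is 1, the two explicit translation constants agree. Since x₁ ≠ x₂, this forces
  -- equal tangent slopes, and by `three_mul_x_flex` the slope of a flex tangent determines 3x.
  have hc : tangentVal P Q = tangentVal (-Q) (-P) := by
    apply mul_right_cancel₀ z3
    rw [← e, ← e']
    field_simp at heq
    linear_combination heq
  rw [tangentVal_neg (three_zsmul_neg hQ), neg_neg] at hc
  rcases P with _ | ⟨x₁, y₁, i₁⟩
  · exact hP0 rfl
  rcases Q with _ | ⟨x₂, y₂, i₂⟩
  · exact hQ0 rfl
  have hx : x₁ ≠ x₂ := fun hx => (Affine.Point.X_eq_iff.mp hx).elim h h'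
  rw [tangentVal_some, tangentVal_some, tangentForm_some, tangentForm_some, tangentSign_neg,
    tangentSign] at hc
  have hslope : W.slope x₁ x₁ y₁ y₁ = W.slope x₂ x₂ y₂ y₂ := by
    apply mul_right_cancel₀ (sub_ne_zero.mpr hx)
    linear_combination hc
  have t₁ := three_mul_x_flex hP
  rw [hslope, ← three_mul_x_flex hQ] at t₁
  exact hx (mul_left_cancel₀ three_ne_zero t₁)

end WeilValue

/-! ### Finiteness of the 3-torsion -/

section FiniteTorsion

open WeierstrassCurve Polynomial

variable {F : Type*} [Field F] [DecidableEq F] {W : WeierstrassCurve.Affine F}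

/-- Eliminates the tangent slope between `slope_flex` and `three_mul_x_flex`. -/
lemma eval_Ψ₃_eq_zero {x y : F} {h : W.Nonsingular x y}
    (h3 : (3 : ℤ) • Affine.Point.some x y h = 0) : W.Ψ₃.eval x = 0 := by
  have e1 := slope_flex h3
  have e2 := three_mul_x_flex h3
  have e3 := (Affine.equation_iff _ _).mp h.1
  simp only [Ψ₃, b₂, b₄, b₆, b₈, eval_add, eval_mul, eval_pow, eval_X, eval_C, eval_ofNat]
  generalize W.slope x x y y = l at e1 e2
  linear_combination (2 * y + W.a₁ * x + W.a₃) ^ 2 * e2 +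
    (l * (2 * y + W.a₁ * x + W.a₃) + 3 * x ^ 2 + 2 * W.a₂ * x + W.a₄ - W.a₁ * y +
      W.a₁ * (2 * y + W.a₁ * x + W.a₃)) * e1 -
    (4 * (3 * x + W.a₂) + W.a₁ ^ 2) * e3

lemma finite_three_torsion [CharZero F] : {P : W.Point | (3 : ℤ) • P = 0}.Finite := by
  have hΨ : W.Ψ₃ ≠ 0 := fun h => W.coeff_Ψ₃_ne_zero three_ne_zero (by rw [h, coeff_zero])
  have hfib (x : F) : {P : W.Point | ∃ y h, P = .some x y h}.Finite := by
    by_cases hx : ∃ y, W.Nonsingular x y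
    · obtain ⟨y, h⟩ := hx
      refine (Set.toFinite {.some x y h, -.some x y h}).subset ?_
      rintro _ ⟨y', h', rfl⟩
      exact Affine.Point.X_eq_iff.mp rfl
    · refine Set.finite_empty.subset ?_
      rintro _ ⟨y', h', rfl⟩
      exact hx ⟨y', h'⟩
  refine ((Set.finite_singleton (0 : W.Point)).union
    (W.Ψ₃.roots.toFinset.finite_toSet.biUnion fun x _ => hfib x)).subset fun P hP => ?_
  rcases P with _ | ⟨x, y, h⟩
  · exact Or.inl rfl
  · refine Or.inr (Set.mem_biUnion (x := x) ?_ ⟨y, h, rfl⟩)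
    simpa [hΨ] using eval_Ψ₃_eq_zero hP

end FiniteTorsion

/-! ### The Weil pairing on `E[3]` -/

section WeilTors

variable {K : Type*} [Field K] [CharZero K] (E : WeierstrassCurve K)

/-- Lets the `finsum` in `starMul` be handled as an ordinary finite sum. -/
instance finite_tors : Finite (Tors E 3) :=
  (finite_three_torsion (W := WeierstrassCurve.Affine.baseChange E (AlgebraicClosure K))).to_subtype

variable {E}

omit [CharZero K] in
lemma three_zsmul_coe (T : Tors E 3) : (3 : ℤ) • T.1 = 0 := T.2

omit [CharZero K] in
lemma three_nsmul_tors (T : Tors E 3) : 3 • T = 0 := by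
  apply Subtype.ext
  rw [AddSubgroup.coe_nsmul, ← natCast_zsmul]
  exact three_zsmul_coe T

variable [E.IsElliptic]

omit [CharZero K] in
instance isElliptic_baseChange :
    (WeierstrassCurve.Affine.baseChange E (AlgebraicClosure K)).IsElliptic :=
  inferInstanceAs (E.map (algebraMap K (AlgebraicClosure K))).IsElliptic

lemma weil_add_right (S T U : Tors E 3) : weil E 3 S (T + U) = weil E 3 S T * weil E 3 S U :=
  weilPairing_add_right (three_zsmul_coe S) (three_zsmul_coe T) (three_zsmul_coe U)

lemma weil_swap (S T : Tors E 3) : weil E 3 T S = (weil E 3 S T)⁻¹ :=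
  weilPairing_swap (three_zsmul_coe S) (three_zsmul_coe T)

lemma weil_self (S : Tors E 3) : weil E 3 S S = 1 := weilPairing_self (three_zsmul_coe S)

lemma weil_ne_zero (S T : Tors E 3) : weil E 3 S T ≠ 0 :=
  weilPairing_ne_zero (three_zsmul_coe S) (three_zsmul_coe T)

lemma weil_add_left (S T U : Tors E 3) : weil E 3 (S + T) U = weil E 3 S U * weil E 3 T U := by
  rw [weil_swap U, weil_add_right, mul_inv, ← weil_swap, ← weil_swap]

lemma weil_zero_right (S : Tors E 3) : weil E 3 S 0 = 1 := by
  have h := weil_add_right S 0 0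
  rw [add_zero] at h
  exact (mul_eq_left₀ (weil_ne_zero S 0)).mp h.symm

lemma weil_nsmul_right (S T : Tors E 3) (n : ℕ) : weil E 3 S (n • T) = weil E 3 S T ^ n := by
  induction n with
  | zero => rw [zero_smul, weil_zero_right, pow_zero]
  | succ n ih => rw [succ_nsmul, weil_add_right, ih, pow_succ]

lemma weil_pow_three (S T : Tors E 3) : weil E 3 S T ^ 3 = 1 := by
  rw [← weil_nsmul_right, three_nsmul_tors, weil_zero_right]

lemma weil_ne_one {S T : Tors E 3} (hS : S ≠ 0) (hT : T ≠ 0) (h : S ≠ T) (h' : S ≠ -T) :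
    weil E 3 S T ≠ 1 :=
  weilPairing_ne_one (three_zsmul_coe S) (three_zsmul_coe T) (fun e => hS (Subtype.ext e))
    (fun e => hT (Subtype.ext e)) (fun e => h (Subtype.ext e)) (fun e => h' (Subtype.ext e))

lemma weilSqrt_add_right (S T U : Tors E 3) :
    weilSqrt E 3 S (T + U) = weilSqrt E 3 S T * weilSqrt E 3 S U := by
  rw [weilSqrt, weil_add_right, mul_pow, weilSqrt, weilSqrt]

lemma weilSqrt_add_left (S T U : Tors E 3) :
    weilSqrt E 3 (S + T) U = weilSqrt E 3 S U * weilSqrt E 3 T U := by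
  rw [weilSqrt, weil_add_left, mul_pow, weilSqrt, weilSqrt]

lemma weilSqrt_self (S : Tors E 3) : weilSqrt E 3 S S = 1 := by
  rw [weilSqrt, weil_self, one_pow]

lemma weilSqrt_swap (S T : Tors E 3) : weilSqrt E 3 T S = weilSqrt E 3 S T ^ 2 := by
  rw [weilSqrt, weil_swap, weilSqrt, ← pow_mul, inv_pow, eq_comm, ← mul_eq_one_iff_eq_inv₀
    (pow_ne_zero _ (weil_ne_zero S T)), ← pow_add]
  change weil E 3 S T ^ (3 * 2) = 1
  rw [pow_mul, weil_pow_three, one_pow]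

lemma weilSqrt_zero_right (S : Tors E 3) : weilSqrt E 3 S 0 = 1 := by
  rw [weilSqrt, weil_zero_right, one_pow]

lemma weilSqrt_zero_left (S : Tors E 3) : weilSqrt E 3 0 S = 1 := by
  rw [weilSqrt_swap S, weilSqrt_zero_right, one_pow]

lemma weilSqrt_nsmul_right (S T : Tors E 3) (n : ℕ) :
    weilSqrt E 3 S (n • T) = weilSqrt E 3 S T ^ n := by
  rw [weilSqrt, weil_nsmul_right, weilSqrt, ← pow_mul, ← pow_mul, mul_comm]

lemma weilSqrt_nsmul_left (S T : Tors E 3) (n : ℕ) :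
    weilSqrt E 3 (n • S) T = weilSqrt E 3 S T ^ n := by
  induction n with
  | zero => rw [zero_smul, weilSqrt_zero_left, pow_zero]
  | succ n ih => rw [succ_nsmul, weilSqrt_add_left, ih, pow_succ]

/-- Nondegeneracy makes the value a primitive cube root of unity; this is 1 + z + z² = 0, the source
of all cancellation in the triple product. -/
lemma weilSqrt_sq_eq {S T : Tors E 3} (hS : S ≠ 0) (hT : T ≠ 0) (h : S ≠ T) (h' : S ≠ -T) :
    weilSqrt E 3 S T ^ 2 = -weilSqrt E 3 S T - 1 := by
  have h1 := weil_ne_one hS hT h h'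
  have h3 := weil_pow_three S T
  have hz : weil E 3 S T ^ 2 = -weil E 3 S T - 1 := by
    apply mul_left_cancel₀ (sub_ne_zero.mpr h1)
    linear_combination h3
  rw [show weilSqrt E 3 S T = weil E 3 S T ^ 2 from rfl]
  generalize weil E 3 S T = z at *
  linear_combination (z ^ 2 - z + 1) * hz

lemma weilSqrt_pow_three (S T : Tors E 3) : weilSqrt E 3 S T ^ 3 = 1 := by
  rw [weilSqrt, ← pow_mul, mul_comm, pow_mul, weil_pow_three, one_pow]

end WeilTors

/-! ### Lines in `E[3]` -/

section Lines

variable {K : Type*} [Field K] {E : WeierstrassCurve K}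

/-- The points of a line through `S` with direction `D`. -/
def linePoint (S D : Tors E 3) (i : Fin 3) : Tors E 3 := S + (i : ℕ) • D

lemma range_linePoint (S D : Tors E 3) :
    Set.range (linePoint S D) = {T | ∃ k : ℤ, T = S + k • D} := by
  ext T
  constructor
  · rintro ⟨i, rfl⟩
    exact ⟨(i : ℕ), by rw [natCast_zsmul]; rfl⟩
  · rintro ⟨k, rfl⟩
    have h3 : (3 : ℤ) • D = 0 := by
      rw [show (3 : ℤ) = ((3 : ℕ) : ℤ) from rfl, natCast_zsmul, three_nsmul_tors]
    have hk : 0 ≤ k % 3 ∧ k % 3 < 3 := by omega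
    refine ⟨⟨(k % 3).toNat, by omega⟩, ?_⟩
    change S + (k % 3).toNat • D = _
    rw [← natCast_zsmul, Int.toNat_of_nonneg hk.1]
    congr 1
    nth_rw 2 [← Int.emod_add_mul_ediv k 3]
    rw [add_smul, mul_comm, mul_smul, h3, smul_zero, add_zero]

lemma linePoint_injective (S : Tors E 3) {D : Tors E 3} (hD : D ≠ 0) :
    Function.Injective (linePoint S D) := by
  have h3 := three_nsmul_tors D
  have h2 : 2 • D ≠ 0 := by
    intro h
    rw [succ_nsmul, h, zero_add] at h3
    exact hD h3
  have h12 : D ≠ 2 • D := by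
    intro h
    rw [two_nsmul, left_eq_add] at h
    exact hD h
  intro i j hij
  have h : (i : ℕ) • D = (j : ℕ) • D := add_left_cancel hij
  fin_cases i <;> fin_cases j <;>
    simp only [Fin.mk_zero, Fin.mk_one, Fin.reduceFinMk, zero_smul, one_smul] at h ⊢
  · exact absurd h.symm hD
  · exact absurd h.symm h2
  · exact absurd h hD
  · exact absurd h h12
  · exact absurd h h2
  · exact absurd h.symm h12

lemma sum_linePoint (S D : Tors E 3) : ∑ i, linePoint S D i = 0 := by
  have h1 := three_nsmul_tors S
  have h2 := three_nsmul_tors D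
  rw [Fin.sum_univ_three]
  simp only [linePoint, Fin.val_zero, Fin.val_one, Fin.val_two]
  have : S + 0 • D + (S + 1 • D) + (S + 2 • D) = 3 • S + 3 • D := by abel
  rw [this, h1, h2, add_zero]

/-- Over 𝔽₃ the four inequalities say exactly that S and D are independent, which is what avoiding 0
amounts to. -/
lemma exists_linePoint (l : LineSet E 3) :
    ∃ S D : Tors E 3, l.1 = Set.range (linePoint S D) ∧ S ≠ 0 ∧ D ≠ 0 ∧ S ≠ D ∧ S ≠ -D := by
  obtain ⟨l, ⟨S, D, hD, rfl⟩, h0⟩ := l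
  refine ⟨S, D, (range_linePoint S D).symm, ?_, hD, ?_, ?_⟩
  · rintro rfl
    exact h0 ⟨0, by simp⟩
  · rintro rfl
    exact h0 ⟨-1, by simp⟩
  · rintro rfl
    exact h0 ⟨1, by simp⟩

/-- A labelling of the points of a line by `Fin 3`. -/
def IsLabelling (l : LineSet E 3) (e : Fin 3 → NonzeroTors E 3) : Prop :=
  Function.Injective e ∧ Set.range (fun i => (e i).1) = l.1

lemma exists_isLabelling (l : LineSet E 3) : ∃ e, IsLabelling l e := by
  obtain ⟨S, D, hl, -, hD, -, -⟩ := exists_linePoint l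
  refine ⟨fun i => ⟨linePoint S D i, fun h => l.2.2 (by rw [hl]; exact ⟨i, h⟩)⟩, ?_, hl.symm⟩
  intro i j h
  exact linePoint_injective S hD (Subtype.ext_iff.mp h)

lemma IsLabelling.coe_injective {l : LineSet E 3} {e : Fin 3 → NonzeroTors E 3}
    (h : IsLabelling l e) : Function.Injective fun i => (e i).1 :=
  Subtype.val_injective.comp h.1

lemma IsLabelling.mem {l : LineSet E 3} {e : Fin 3 → NonzeroTors E 3}
    (h : IsLabelling l e) (i : Fin 3) : (e i).1 ∈ l.1 := h.2 ▸ ⟨i, rfl⟩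

lemma IsLabelling.smul {l : LineSet E 3} {e : Fin 3 → NonzeroTors E 3}
    (h : IsLabelling l e) (σ : GK K) : IsLabelling (σ • l) (fun i => σ • e i) := by
  refine ⟨(MulAction.injective σ).comp h.1, ?_⟩
  change _ = (fun T => σ • T) '' l.1
  rw [← h.2, ← Set.range_comp]
  rfl

lemma IsLabelling.sum_eq_zero {l : LineSet E 3} {e : Fin 3 → NonzeroTors E 3}
    (h : IsLabelling l e) : ∑ i, (e i).1 = 0 := by
  obtain ⟨S, D, hl, -, hD, -, -⟩ := exists_linePoint l
  rw [← finsum_eq_sum_of_fintype, ← finsum_mem_range h.coe_injective (f := fun T => T), h.2, hl,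
    finsum_mem_range (linePoint_injective S hD), finsum_eq_sum_of_fintype, sum_linePoint]

/-- A line has three points, so three labels covering it are automatically distinct. -/
lemma isLabelling_of_eq {l : LineSet E 3} {S₁ S₂ S₃ : NonzeroTors E 3}
    (h : l.1 = {S₁.1, S₂.1, S₃.1}) : IsLabelling l ![S₁, S₂, S₃] := by
  have hr : Set.range (fun i => (![S₁, S₂, S₃] i).1) = l.1 := by
    rw [h]
    ext T
    simp [Fin.exists_fin_succ, eq_comm]
  refine ⟨?_, hr⟩
  obtain ⟨e, he⟩ := exists_isLabelling l
  have h3 : l.1.ncard = 3 := by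
    rw [← he.2, ← Set.image_univ, Set.ncard_image_of_injective _ he.coe_injective]
    simp
  have : Function.Injective fun i => (![S₁, S₂, S₃] i).1 := by
    rw [← Set.injOn_univ]
    apply Set.injOn_of_ncard_image_eq
    · rw [Set.image_univ, hr, h3]
      simp
    · exact Set.finite_univ
  exact Function.Injective.of_comp (f := Subtype.val) this

end Lines

/-! ### The étale algebra `M` is free of rank `3` over `L'` -/

section Separating

variable {K : Type*} [Field K] {E : WeierstrassCurve K}

/-- The `x`-coordinate, with junk value `0` at infinity. -/
def xCoord : GeomPoint E → AlgebraicClosure K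
  | .zero => 0
  | .some x _ _ => x

/-- The `y`-coordinate, with junk value `0` at infinity. -/
def yCoord : GeomPoint E → AlgebraicClosure K
  | .zero => 0
  | .some _ y _ => y

lemma xCoord_galMap (σ : GK K) (P : GeomPoint E) : xCoord (galMap E σ P) = σ (xCoord P) := by
  rcases P with _ | ⟨x, y, h⟩
  · exact (map_zero σ).symm
  · rfl

lemma yCoord_galMap (σ : GK K) (P : GeomPoint E) : yCoord (galMap E σ P) = σ (yCoord P) := by
  rcases P with _ | ⟨x, y, h⟩
  · exact (map_zero σ).symm
  · rfl

lemma eq_of_coord_eq {P Q : GeomPoint E} (hP : P ≠ 0) (hQ : Q ≠ 0) (hx : xCoord P = xCoord Q)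
    (hy : yCoord P = yCoord Q) : P = Q := by
  rcases P with _ | ⟨x, y, h⟩
  · exact absurd rfl hP
  rcases Q with _ | ⟨x', y', h'⟩
  · exact absurd rfl hQ
  · obtain rfl : x = x' := hx
    obtain rfl : y = y' := hy
    rfl

/-- Some function in `L` separates the nonzero `3`-torsion points. -/
lemma exists_separating [CharZero K] : ∃ m : algL E 3, Function.Injective m.1 := by
  let f (c : K) : algL E 3 := ⟨fun T => xCoord T.1.1 + algebraMap K _ c * yCoord T.1.1, by
    intro σ T
    change xCoord (galMap E σ T.1.1) + _ * yCoord (galMap E σ T.1.1) = _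
    rw [xCoord_galMap, yCoord_galMap, map_add, map_mul, AlgEquiv.commutes]⟩
  -- Two distinct points share a value of x + c * y for at most one c, and K is infinite.
  have hbad (T T' : NonzeroTors E 3) : {c : K | T ≠ T' ∧ (f c).1 T = (f c).1 T'}.Finite := by
    apply Set.Subsingleton.finite
    rintro c ⟨hT, hc⟩ c' ⟨-, hc'⟩
    change xCoord T.1.1 + algebraMap K _ c * yCoord T.1.1 =
      xCoord T'.1.1 + algebraMap K _ c * yCoord T'.1.1 at hc
    change xCoord T.1.1 + algebraMap K _ c' * yCoord T.1.1 =
      xCoord T'.1.1 + algebraMap K _ c' * yCoord T'.1.1 at hc'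
    by_contra hne
    have hy : yCoord T.1.1 = yCoord T'.1.1 := by
      have : algebraMap K (AlgebraicClosure K) c - algebraMap K _ c' ≠ 0 :=
        sub_ne_zero.mpr fun h => hne ((algebraMap K (AlgebraicClosure K)).injective h)
      apply mul_left_cancel₀ this
      linear_combination hc - hc'
    rw [hy, add_left_inj] at hc
    exact hT (Subtype.ext (Subtype.ext (eq_of_coord_eq (fun h => T.2 (Subtype.ext h))
      (fun h => T'.2 (Subtype.ext h)) hc hy)))
  obtain ⟨c, hc⟩ := (Set.finite_iUnion fun p : NonzeroTors E 3 × NonzeroTors E 3 =>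
    hbad p.1 p.2).infinite_compl.nonempty
  refine ⟨f c, fun T T' h => ?_⟩
  by_contra hne
  exact hc (Set.mem_iUnion.mpr ⟨(T, T'), hne, h⟩)

end Separating

/-! ### Interpolation on lines, and norm and trace from `M` to `L'` -/

section Free

variable {K : Type*} [Field K] {E : WeierstrassCurve K}

/-- Evaluation at a line, as a ring homomorphism. -/
def evalLine (l : LineSet E 3) : algL' E 3 →+* AlgebraicClosure K :=
  (Pi.evalRingHom _ l).comp (etaleAlgebra K (LineSet E 3)).val.toRingHom

/-- Evaluation at a flag, as a ring homomorphism. -/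
def evalFlag (x : Flags E 3) : algM E 3 →+* AlgebraicClosure K :=
  (Pi.evalRingHom _ x).comp (etaleAlgebra K (Flags E 3)).val.toRingHom

lemma evalFlag_smul (a : algL' E 3) (f : algM E 3) (x : Flags E 3) :
    evalFlag x (a • f) = evalLine x.1.2 a * evalFlag x f := rfl

lemma evalFlag_inclLM (a : algL E 3) (x : Flags E 3) :
    evalFlag x (inclLM E 3 a) = a.1 x.1.1 := rfl

/-- The flag given by the `i`-th point of a labelled line. -/
def IsLabelling.flag {l : LineSet E 3} {e : Fin 3 → NonzeroTors E 3} (h : IsLabelling l e)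
    (i : Fin 3) : Flags E 3 := ⟨(e i, l), h.mem i⟩

variable {m : algL E 3}

lemma det_vandermonde_ne_zero (hm : Function.Injective m.1) {l : LineSet E 3}
    {e : Fin 3 → NonzeroTors E 3} (h : IsLabelling l e) :
    (Matrix.vandermonde fun i => m.1 (e i)).det ≠ 0 :=
  Matrix.det_vandermonde_ne_zero_iff.mpr (hm.comp h.1)

/-- Lagrange interpolation on a line. -/
lemma existsUnique_interpolation (hm : Function.Injective m.1) (f : algM E 3) (l : LineSet E 3) :
    ∃! a : Fin 3 → AlgebraicClosure K, ∀ x : Flags E 3, x.1.2 = l →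
      ∑ j, a j * m.1 x.1.1 ^ (j : ℕ) = f.1 x := by
  obtain ⟨e, he⟩ := exists_isLabelling l
  have hdet := det_vandermonde_ne_zero hm he
  have hV (a : Fin 3 → AlgebraicClosure K) : (∀ x : Flags E 3, x.1.2 = l →
      ∑ j, a j * m.1 x.1.1 ^ (j : ℕ) = f.1 x) ↔
      (Matrix.vandermonde fun i => m.1 (e i)).mulVec a = fun i => f.1 (he.flag i) := by
    constructor
    · intro h
      ext i
      rw [← h (he.flag i) rfl]
      simp only [Matrix.mulVec, dotProduct, Matrix.vandermonde_apply]
      exact Finset.sum_congr rfl fun j _ => mul_comm _ _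
    · rintro h ⟨⟨T, l'⟩, hT⟩ (rfl : l' = l)
      have hT' : T.1 ∈ Set.range (fun i => (e i).1) := by rw [he.2]; exact hT
      obtain ⟨i, hi⟩ := hT'
      obtain rfl : e i = T := Subtype.ext hi
      have := congrFun h i
      simp only [Matrix.mulVec, dotProduct, Matrix.vandermonde_apply] at this
      refine Eq.trans (Finset.sum_congr rfl fun j _ => mul_comm _ _) this
  refine ⟨(Matrix.vandermonde fun i => m.1 (e i))⁻¹.mulVec fun i => f.1 (he.flag i),
    (hV _).mpr ?_, fun a ha => ?_⟩
  · rw [Matrix.mulVec_mulVec, Matrix.mul_nonsing_inv _ (isUnit_iff_ne_zero.mpr hdet),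
      Matrix.one_mulVec]
  · rw [← (hV a).mp ha, Matrix.mulVec_mulVec,
      Matrix.nonsing_inv_mul _ (isUnit_iff_ne_zero.mpr hdet), Matrix.one_mulVec]

/-- Interpolation is done line by line over the algebraic closure; uniqueness makes the coefficients
Galois-equivariant, so they descend to `L'`. -/
lemma exists_coefficients (hm : Function.Injective m.1) (f : algM E 3) :
    ∃ a : Fin 3 → algL' E 3, ∑ j, a j • inclLM E 3 m ^ (j : ℕ) = f := by
  choose a ha hu using fun l => existsUnique_interpolation hm f l
  have hequiv (j : Fin 3) (σ : GK K) (l : LineSet E 3) : a (σ • l) j = σ (a l j) := by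
    have : (fun j => σ (a l j)) = a (σ • l) := by
      apply hu
      intro x hx
      have hx' : (σ⁻¹ • x).1.2 = l := by
        change σ⁻¹ • x.1.2 = l
        rw [hx, inv_smul_smul]
      have e := congrArg σ (ha l (σ⁻¹ • x) hx')
      rw [← f.2, smul_inv_smul, map_sum] at e
      rw [← e]
      refine Finset.sum_congr rfl fun j _ => ?_
      rw [map_mul, map_pow]
      congr 2
      change m.1 x.1.1 = σ (m.1 (σ⁻¹ • x.1.1))
      rw [← m.2, smul_inv_smul]
    exact (congrFun this j).symm
  let b (j : Fin 3) : algL' E 3 := ⟨fun l => a l j, hequiv j⟩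
  refine ⟨b, Subtype.ext (funext fun x => ?_)⟩
  change evalFlag x (∑ j, b j • inclLM E 3 m ^ (j : ℕ)) = f.1 x
  rw [map_sum, ← ha x.1.2 x rfl]
  rfl

lemma coefficients_unique (hm : Function.Injective m.1) {a : Fin 3 → algL' E 3}
    (h : ∑ j, a j • inclLM E 3 m ^ (j : ℕ) = 0) : a = 0 := by
  funext j
  apply Subtype.ext
  funext l
  have hu := (existsUnique_interpolation hm (0 : algM E 3) l).unique (y₁ := fun j => (a j).1 l)
    (y₂ := 0) ?_ ?_
  · exact congrFun hu j
  · rintro x rfl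
    have := congrArg (evalFlag x) h
    rw [map_sum] at this
    exact this
  · intro x _
    simp only [Pi.zero_apply, zero_mul, Finset.sum_const_zero]
    rfl

/-- The powers of a separating function form a basis of `M` over `L'`. -/
def powerBasisLM (hm : Function.Injective m.1) : Module.Basis (Fin 3) (algL' E 3) (algM E 3) :=
  Module.Basis.mk (v := fun j : Fin 3 => inclLM E 3 m ^ (j : ℕ))
    (Fintype.linearIndependent_iff.mpr fun _ h => congrFun (coefficients_unique hm h))
    fun f _ => by
      obtain ⟨a, rfl⟩ := exists_coefficients hm f
      exact Submodule.sum_mem _ fun j _ => Submodule.smul_mem _ _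
        (Submodule.subset_span ⟨j, rfl⟩)

/-- The Vandermonde matrix expresses evaluation at the three flags over `l` in the power basis, so
it conjugates multiplication by `f` to the diagonal matrix of values. -/
lemma diagonal_mul_vandermonde (hm : Function.Injective m.1) {l : LineSet E 3}
    {e : Fin 3 → NonzeroTors E 3} (h : IsLabelling l e) (f : algM E 3) :
    Matrix.diagonal (fun i => f.1 (h.flag i)) * Matrix.vandermonde (fun i => m.1 (e i)) =
      Matrix.vandermonde (fun i => m.1 (e i)) *
        (Algebra.leftMulMatrix (powerBasisLM hm) f).map (evalLine l) := by
  ext i j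
  rw [Matrix.diagonal_mul, Matrix.mul_apply]
  have key := congrArg (evalFlag (h.flag i)) ((powerBasisLM hm).sum_repr
    (f * powerBasisLM hm j))
  rw [map_sum, map_mul (evalFlag (h.flag i))] at key
  simp only [evalFlag_smul, powerBasisLM, Module.Basis.mk_apply, map_pow, evalFlag_inclLM] at key
  refine key.symm.trans (Finset.sum_congr rfl fun k _ => ?_)
  rw [Matrix.map_apply, Algebra.leftMulMatrix_eq_repr_mul, mul_comm, Matrix.vandermonde_apply]
  simp only [powerBasisLM, Module.Basis.mk_apply]
  rfl

variable [CharZero K]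

/-- The basis `powerBasisLM` makes `Algebra.norm` a genuine determinant rather than its default
value 1; conjugate matrices have equal determinant. -/
lemma norm_algM_apply {l : LineSet E 3} {e : Fin 3 → NonzeroTors E 3} (h : IsLabelling l e)
    (f : algM E 3) : (Algebra.norm (algL' E 3) f).1 l = ∏ i, f.1 (h.flag i) := by
  obtain ⟨m, hm⟩ := exists_separating (E := E)
  have key := congrArg (fun A => A.det) (diagonal_mul_vandermonde hm h f)
  rw [Matrix.det_mul, Matrix.det_mul, mul_comm, Matrix.det_diagonal] at key
  have key' := mul_left_cancel₀ (det_vandermonde_ne_zero hm h) key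
  rw [key', Algebra.norm_eq_matrix_det (powerBasisLM hm)]
  exact (evalLine l).map_det (Algebra.leftMulMatrix (powerBasisLM hm) f)

lemma trace_algM_apply {l : LineSet E 3} {e : Fin 3 → NonzeroTors E 3} (h : IsLabelling l e)
    (f : algM E 3) : (Algebra.trace (algL' E 3) (algM E 3) f).1 l = ∑ i, f.1 (h.flag i) := by
  obtain ⟨m, hm⟩ := exists_separating (E := E)
  have hu := isUnit_iff_ne_zero.mpr (det_vandermonde_ne_zero hm h)
  have key := congrArg (fun A => ((Matrix.vandermonde fun i => m.1 (e i))⁻¹ * A).trace)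
    (diagonal_mul_vandermonde hm h f)
  rw [← Matrix.mul_assoc, ← Matrix.mul_assoc, Matrix.nonsing_inv_mul _ hu, Matrix.one_mul,
    Matrix.trace_mul_comm, ← Matrix.mul_assoc, Matrix.mul_nonsing_inv _ hu, Matrix.one_mul,
    Matrix.trace_diagonal] at key
  rw [key, Algebra.trace_eq_matrix_trace (powerBasisLM hm)]
  exact AddMonoidHom.map_trace (evalLine l) (Algebra.leftMulMatrix (powerBasisLM hm) f)

end Free

/-! ### Triple products for `*_ρ` -/

section Star

variable {K : Type*} [Field K] [CharZero K] {E : WeierstrassCurve K}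

open Classical in
omit [CharZero K] in
lemma starMul_single (ρ : algR E 3 ⊗[K] algR E 3) (a b : Tors E 3) (x y : AlgebraicClosure K) :
    starMul E 3 ρ (Pi.single a x) (Pi.single b y) =
      Pi.single (a + b) (weilSqrt E 3 a b * pairValue E 3 ρ a b * x * y) := by
  funext T
  rw [starMul, finsum_eq_single _ a]
  · rw [Pi.single_eq_same]
    by_cases h : T = a + b
    · subst h
      rw [add_sub_cancel_left, Pi.single_eq_same, Pi.single_eq_same]
    · rw [Pi.single_eq_of_ne h, Pi.single_eq_of_ne (fun h' => h (by rw [← h']; abel)), mul_zero]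
  · intro T' hT'
    rw [Pi.single_eq_of_ne hT', mul_zero, zero_mul]

lemma starMul_sum_left (ρ : algR E 3 ⊗[K] algR E 3) {ι : Type*} (s : Finset ι)
    (f : ι → Tors E 3 → AlgebraicClosure K) (g : Tors E 3 → AlgebraicClosure K) :
    starMul E 3 ρ (∑ i ∈ s, f i) g = ∑ i ∈ s, starMul E 3 ρ (f i) g := by
  have := Fintype.ofFinite (Tors E 3)
  funext T
  simp only [starMul, finsum_eq_sum_of_fintype, Finset.sum_apply]
  rw [Finset.sum_comm]
  simp only [Finset.mul_sum, Finset.sum_mul]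

lemma starMul_sum_right (ρ : algR E 3 ⊗[K] algR E 3) {ι : Type*} (s : Finset ι)
    (f : Tors E 3 → AlgebraicClosure K) (g : ι → Tors E 3 → AlgebraicClosure K) :
    starMul E 3 ρ f (∑ i ∈ s, g i) = ∑ i ∈ s, starMul E 3 ρ f (g i) := by
  have := Fintype.ofFinite (Tors E 3)
  funext T
  simp only [starMul, finsum_eq_sum_of_fintype, Finset.sum_apply]
  rw [Finset.sum_comm]
  simp only [Finset.mul_sum]

open Classical in
omit [CharZero K] in
lemma delta_range {e : Fin 3 → Tors E 3} (he : Function.Injective e) :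
    delta E 3 (Set.range e) = ∑ i, Pi.single (e i) 1 := by
  funext T
  rw [Finset.sum_apply, delta]
  by_cases h : T ∈ Set.range e
  · obtain ⟨i, rfl⟩ := h
    rw [Set.indicator_of_mem (Set.mem_range_self i), Finset.sum_eq_single i, Pi.single_eq_same, Pi.one_apply]
    · intro j _ hj
      exact Pi.single_eq_of_ne (fun h => hj (he h).symm) 1
    · simp
  · rw [Set.indicator_of_notMem h, Finset.sum_eq_zero]
    intro i _
    exact Pi.single_eq_of_ne (fun h' => h ⟨i, h'.symm⟩) 1

variable [E.IsElliptic]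

/-- By bilinearity and alternation the exponent is j - i; `2 * i` stands for -i modulo 3 to stay in
ℕ. -/
lemma weilSqrt_linePoint (S D : Tors E 3) (i j : Fin 3) :
    weilSqrt E 3 (linePoint S D i) (linePoint S D j) =
      weilSqrt E 3 S D ^ ((j : ℕ) + 2 * (i : ℕ)) := by
  rw [linePoint, linePoint, weilSqrt_add_left, weilSqrt_add_right, weilSqrt_add_right,
    weilSqrt_self, weilSqrt_nsmul_left, weilSqrt_nsmul_right, weilSqrt_nsmul_left,
    weilSqrt_nsmul_right, weilSqrt_self, weilSqrt_swap S D]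
  ring

omit [CharZero K] [E.IsElliptic] in
lemma linePoint_add_add (S D : Tors E 3) (i j k : Fin 3) :
    linePoint S D i + linePoint S D j + linePoint S D k = ((i + j + k : Fin 3) : ℕ) • D := by
  have h : linePoint S D i + linePoint S D j + linePoint S D k =
      3 • S + ((i : ℕ) + j + k) • D := by
    simp only [linePoint]
    rw [add_smul, add_smul]
    abel
  rw [h, three_nsmul_tors, zero_add]
  have hmod (n : ℕ) : n • D = (n % 3) • D := by
    nth_rw 1 [← Nat.mod_add_div n 3]
    rw [add_smul, mul_comm, mul_smul, three_nsmul_tors, smul_zero, add_zero]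
  rw [hmod, Fin.val_add, Fin.val_add, Nat.mod_add_mod]

omit [CharZero K] in
-- The weight is z^(i-k). For i + j + k ≠ 0 each multiset {a, a, b} has three orderings with weights
-- 1, z, z², which cancel. For i + j + k = 0 the constant triples have weight 1 and the six
-- permutations weigh 3z + 3z² = -3.
lemma sum_cube_root (z : AlgebraicClosure K) (hz : z ^ 2 = -z - 1)
    (g s : Fin 3 → AlgebraicClosure K) :
    ∑ i : Fin 3, ∑ j : Fin 3, ∑ k : Fin 3,
      s (i + j + k) * (z ^ ((i : ℕ) + 2 * (k : ℕ)) * (g i * g j * g k)) =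
      (∑ i, g i ^ 3 - 3 * ∏ i, g i) * s 0 := by
  have h3 : z ^ 3 = 1 := by linear_combination (z - 1) * hz
  have h4 : z ^ 4 = z := by rw [pow_succ, h3, one_mul]
  have h5 : z ^ 5 = -z - 1 := by rw [pow_succ, h4, ← hz, pow_two]
  have h6 : z ^ 6 = 1 := by rw [show (6 : ℕ) = 3 * 2 from rfl, pow_mul, h3, one_pow]
  simp only [Fin.sum_univ_three, Fin.prod_univ_three, Fin.isValue, Fin.val_zero, Fin.val_one, Fin.val_two,
    show (0 : Fin 3) + 0 = 0 from rfl, show (0 : Fin 3) + 1 = 1 from rfl,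
    show (0 : Fin 3) + 2 = 2 from rfl, show (1 : Fin 3) + 0 = 1 from rfl,
    show (1 : Fin 3) + 1 = 2 from rfl, show (1 : Fin 3) + 2 = 0 from rfl,
    show (2 : Fin 3) + 0 = 2 from rfl, show (2 : Fin 3) + 1 = 0 from rfl,
    show (2 : Fin 3) + 2 = 1 from rfl, Nat.reduceMul, Nat.reduceAdd, hz, h3, h4, h5, h6,
    pow_zero, pow_one]
  ring

variable {ρ : algR E 3 ⊗[K] algR E 3} {γ : Tors E 3 → (AlgebraicClosure K)ˣ}

open Classical in
lemma starMul_triple (hγ : γ 0 = 1) {S D : Tors E 3} (hS : S ≠ 0)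
    (hD : D ≠ 0) (h : S ≠ D) (h' : S ≠ -D) :
    ∑ i, ∑ j, ∑ k, Pi.single (linePoint S D i + linePoint S D j + linePoint S D k)
      (weilSqrt E 3 (linePoint S D i) (linePoint S D j) *
        weilSqrt E 3 (linePoint S D i) (linePoint S D k) *
        weilSqrt E 3 (linePoint S D j) (linePoint S D k) *
        ((γ (linePoint S D i) * γ (linePoint S D j) * γ (linePoint S D k) : AlgebraicClosure K) /
          γ (linePoint S D i + linePoint S D j + linePoint S D k))) =
      (∑ i, (γ (linePoint S D i) : AlgebraicClosure K) ^ 3 -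
        3 * ∏ i, (γ (linePoint S D i) : AlgebraicClosure K)) • delta E 3 {0} := by
  have hz := weilSqrt_sq_eq hS hD h h'
  have hz3 := weilSqrt_pow_three S D
  set z := weilSqrt E 3 S D with hzdef
  funext T
  -- Evaluated at T, the factor depending only on i + j + k is the indicator of (i+j+k)D divided by
  -- γ there; at 0 the normalisation γ(0) = 1 removes the denominator.
  have key := sum_cube_root z hz (fun i => (γ (linePoint S D i) : AlgebraicClosure K))
    (fun n => (Pi.single ((n : ℕ) • D) 1 : Tors E 3 → AlgebraicClosure K) T /
      γ ((n : ℕ) • D))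
  have hd : (Pi.single ((0 : ℕ) • D) 1 : Tors E 3 → AlgebraicClosure K) T /
      γ ((0 : ℕ) • D) = delta E 3 {0} T := by
    rw [zero_smul, hγ, Units.val_one, div_one, delta]
    by_cases hT : T = 0
    · subst hT
      simp
    · rw [Pi.single_eq_of_ne hT, Set.indicator_of_notMem (by simpa using hT)]
  rw [Fin.val_zero, hd] at key
  rw [Pi.smul_apply, smul_eq_mul, ← key]
  simp only [Finset.sum_apply]
  refine Finset.sum_congr rfl fun i _ => Finset.sum_congr rfl fun j _ =>
    Finset.sum_congr rfl fun k _ => ?_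
  rw [linePoint_add_add, weilSqrt_linePoint, weilSqrt_linePoint, weilSqrt_linePoint, ← hzdef]
  have hc : z ^ ((j : ℕ) + 2 * (i : ℕ)) * z ^ ((k : ℕ) + 2 * (i : ℕ)) *
      z ^ ((k : ℕ) + 2 * (j : ℕ)) = z ^ ((i : ℕ) + 2 * (k : ℕ)) := by
    calc _ = (z ^ 3) ^ ((i : ℕ) + j) * z ^ ((i : ℕ) + 2 * (k : ℕ)) := by ring
      _ = _ := by rw [hz3, one_pow, one_mul]
  rw [hc]
  by_cases hT : T = ((i + j + k : Fin 3) : ℕ) • D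
  · rw [← hT, Pi.single_eq_same, Pi.single_eq_same]
    ring
  · rw [Pi.single_eq_of_ne hT, Pi.single_eq_of_ne hT]
    ring

/-- The intermediate factor γ(a + b) cancels because `ρ` is a coboundary; the other bracketing
reaches the same expression, so the two triple products agree. -/
lemma starMul_coeff_left (hρ : ∀ S T, pairValue E 3 ρ S T = γ S * γ T / γ (S + T))
    (a b c : Tors E 3) :
    weilSqrt E 3 (a + b) c * pairValue E 3 ρ (a + b) c *
        (weilSqrt E 3 a b * pairValue E 3 ρ a b * 1 * 1) * 1 =
      weilSqrt E 3 a b * weilSqrt E 3 a c * weilSqrt E 3 b c *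
        ((γ a * γ b * γ c : AlgebraicClosure K) / γ (a + b + c)) := by
  rw [weilSqrt_add_left, hρ, hρ]
  have h1 := (γ (a + b)).ne_zero
  have h2 := (γ (a + b + c)).ne_zero
  field_simp

lemma starMul_coeff_right (hρ : ∀ S T, pairValue E 3 ρ S T = γ S * γ T / γ (S + T))
    (a b c : Tors E 3) :
    weilSqrt E 3 a (b + c) * pairValue E 3 ρ a (b + c) * 1 *
        (weilSqrt E 3 b c * pairValue E 3 ρ b c * 1 * 1) =
      weilSqrt E 3 a b * weilSqrt E 3 a c * weilSqrt E 3 b c *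
        ((γ a * γ b * γ c : AlgebraicClosure K) / γ (a + b + c)) := by
  rw [weilSqrt_add_right, hρ, hρ, add_assoc]
  have h1 := (γ (b + c)).ne_zero
  have h2 := (γ (a + (b + c))).ne_zero
  field_simp

/-- The triple product of the indicator function of a line, bracketed to the left. -/
lemma starMul_delta_left (hγ : γ 0 = 1)
    (hρ : ∀ S T, pairValue E 3 ρ S T = γ S * γ T / γ (S + T)) {S D : Tors E 3} (hS : S ≠ 0)
    (hD : D ≠ 0) (h : S ≠ D) (h' : S ≠ -D) :
    starMul E 3 ρ (starMul E 3 ρ (delta E 3 (Set.range (linePoint S D)))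
      (delta E 3 (Set.range (linePoint S D)))) (delta E 3 (Set.range (linePoint S D))) =
      (∑ i, (γ (linePoint S D i) : AlgebraicClosure K) ^ 3 -
        3 * ∏ i, (γ (linePoint S D i) : AlgebraicClosure K)) • delta E 3 {0} := by
  classical
  rw [← starMul_triple hγ hS hD h h', delta_range (linePoint_injective S hD)]
  simp_rw [starMul_sum_left, starMul_sum_right, starMul_sum_left, starMul_single]
  refine Finset.sum_congr rfl fun i _ => ?_
  rw [Finset.sum_comm]
  refine Finset.sum_congr rfl fun j _ => Finset.sum_congr rfl fun k _ => ?_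
  rw [starMul_coeff_left hρ]

/-- The triple product of the indicator function of a line, bracketed to the right. -/
lemma starMul_delta_right (hγ : γ 0 = 1)
    (hρ : ∀ S T, pairValue E 3 ρ S T = γ S * γ T / γ (S + T)) {S D : Tors E 3} (hS : S ≠ 0)
    (hD : D ≠ 0) (h : S ≠ D) (h' : S ≠ -D) :
    starMul E 3 ρ (delta E 3 (Set.range (linePoint S D)))
      (starMul E 3 ρ (delta E 3 (Set.range (linePoint S D)))
        (delta E 3 (Set.range (linePoint S D)))) =
      (∑ i, (γ (linePoint S D i) : AlgebraicClosure K) ^ 3 -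
        3 * ∏ i, (γ (linePoint S D i) : AlgebraicClosure K)) • delta E 3 {0} := by
  classical
  rw [← starMul_triple hγ hS hD h h', delta_range (linePoint_injective S hD)]
  simp_rw [starMul_sum_left, starMul_sum_right, starMul_single]
  refine Finset.sum_congr rfl fun i _ => Finset.sum_congr rfl fun j _ =>
    Finset.sum_congr rfl fun k _ => ?_
  rw [starMul_coeff_right hρ, ← add_assoc]

end Star

/-! ### The product of `γ` along a line as an element of `L'` -/

section LineProduct

variable {K : Type*} [Field K] {E : WeierstrassCurve K}

lemma finprod_mem_line {l : LineSet E 3} {e : Fin 3 → NonzeroTors E 3} (h : IsLabelling l e)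
    (f : Tors E 3 → AlgebraicClosure K) : ∏ᶠ T ∈ l.1, f T = ∏ i, f (e i).1 := by
  rw [← h.2, finprod_mem_range h.coe_injective, finprod_eq_prod_of_fintype]

variable [CharZero K] [E.IsElliptic]

lemma prod_weil_eq_one {l : LineSet E 3} {e : Fin 3 → NonzeroTors E 3} (h : IsLabelling l e)
    (S : Tors E 3) : ∏ i, weil E 3 S (e i).1 = 1 := by
  have h0 := h.sum_eq_zero
  rw [Fin.sum_univ_three] at h0
  rw [Fin.prod_univ_three, ← weil_add_right, ← weil_add_right, h0, weil_zero_right]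

/-- The product over the points of a line of a trivialisation of the cocycle `e_3(ξ_σ, -)`, as an
element of `L'`. -/
def lineProduct (c : GK K → Tors E 3) (γ : Tors E 3 → (AlgebraicClosure K)ˣ)
    (hc : ∀ (σ : GK K) (T : Tors E 3),
      weil E 3 (c σ) T = σ (γ (σ⁻¹ • T) : AlgebraicClosure K) / γ T) : algL' E 3 :=
  ⟨fun l => ∏ᶠ T ∈ l.1, (γ T : AlgebraicClosure K), by
    intro σ l
    obtain ⟨e, he⟩ := exists_isLabelling l
    dsimp only
    -- The inserted factor 1 is ∏ e₃(c_σ, σTᵢ), trivial because the points of σλ sum to 0; termwise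
    -- it turns γ(σTᵢ) into σ(γ(Tᵢ)).
    rw [finprod_mem_line he, finprod_mem_line (he.smul σ), map_prod,
      ← one_mul (∏ i, (γ (σ • e i).1 : AlgebraicClosure K)), ← prod_weil_eq_one (he.smul σ) (c σ),
      ← Finset.prod_mul_distrib]
    refine Finset.prod_congr rfl fun i _ => ?_
    rw [hc, div_mul_cancel₀ _ (Units.ne_zero _)]
    change σ (γ (σ⁻¹ • σ • (e i).1)) = _
    rw [inv_smul_smul]⟩

end LineProduct

end

end CasselsTate

/-! ### Proof of the main theorem -/

open CasselsTate
theorem mainTheorem5 {K : Type*} [Field K] [CharZero K] (E : WeierstrassCurve K) [E.IsElliptic]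
    (ξ : H1 E 3) (α : (algL E 3)ˣ)
    (ρ : (algR E 3 ⊗[K] algR E 3)ˣ)
    (hc : Compatible E 3 ξ α ρ) :
    ∃ α' : algL' E 3,
      (∀ l : LineSet E 3,
        starMul E 3 ρ.val (starMul E 3 ρ.val
            (delta E 3 l.1) (delta E 3 l.1)) (delta E 3 l.1)
          = α'.1 l • delta E 3 {0} ∧
        starMul E 3 ρ.val (delta E 3 l.1) (starMul E 3 ρ.val
            (delta E 3 l.1) (delta E 3 l.1))
          = α'.1 l • delta E 3 {0}) ∧
      (∀ (l : LineSet E 3) (S₁ S₂ S₃ : NonzeroTors E 3),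
        l.1 = {S₁.1, S₂.1, S₃.1} →
        α'.1 l = α.val.1 S₁ + α.val.1 S₂ + α.val.1 S₃ -
          3 * pairValue E 3 ρ.val S₁.1 S₂.1 *
            pairValue E 3 ρ.val S₃.1 (-S₃.1)) ∧
      ∃ s : algL' E 3,
        s ^ 3 = Algebra.norm (algL' E 3) (inclLM E 3 α.val) ∧
        α' = Algebra.trace (algL' E 3) (algM E 3)
              (inclLM E 3 α.val) - 3 * s := by
  obtain ⟨c, γ, -, hγ, hγ0, hα, hρ⟩ := hc
  let s : algL' E 3 := lineProduct c.1 γ hγ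
  have hs {l : LineSet E 3} {e : Fin 3 → NonzeroTors E 3} (he : IsLabelling l e) :
      s.1 l = ∏ i, (γ (e i).1 : AlgebraicClosure K) := finprod_mem_line he _
  have hval {l : LineSet E 3} {e : Fin 3 → NonzeroTors E 3} (he : IsLabelling l e) :
      (Algebra.trace (algL' E 3) (algM E 3) (inclLM E 3 α.val) - 3 * s).1 l =
        ∑ i, α.val.1 (e i) - 3 * ∏ i, (γ (e i).1 : AlgebraicClosure K) := by
    rw [← hs he]
    change (Algebra.trace (algL' E 3) (algM E 3) (inclLM E 3 α.val)).1 l - 3 * s.1 l = _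
    rw [trace_algM_apply he]
    rfl
  -- The final `rfl` fixes the witness α' as Tr(α) - 3s.
  refine ⟨_, fun l => ?_, fun l S₁ S₂ S₃ hl => ?_, s, Subtype.ext (funext fun l => ?_), rfl⟩
  · obtain ⟨S, D, hl, hS, hD, h, h'⟩ := exists_linePoint l
    have he : IsLabelling l fun i =>
        (⟨linePoint S D i, fun h => l.2.2 (by rw [hl]; exact ⟨i, h⟩)⟩ : NonzeroTors E 3) :=
      ⟨fun i j h => linePoint_injective S hD (Subtype.ext_iff.mp h), hl.symm⟩
    rw [hval he]
    simp only [← hα]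
    rw [hl]
    exact ⟨starMul_delta_left hγ0 hρ hS hD h h', starMul_delta_right hγ0 hρ hS hD h h'⟩
  · have he := isLabelling_of_eq hl
    have h0 := he.sum_eq_zero
    rw [hval he, hρ, hρ, add_neg_cancel, hγ0]
    rw [Fin.sum_univ_three] at h0 ⊢
    rw [Fin.prod_univ_three]
    -- Hence γ(-S₃) cancels the denominator of ρ(S₁, S₂), and the product of the two values of ρ is
    -- γ(S₁)γ(S₂)γ(S₃).
    have h12 : -S₃.1 = S₁.1 + S₂.1 := neg_eq_of_add_eq_zero_left h0
    change _ - 3 * ((γ S₁.1 : AlgebraicClosure K) * γ S₂.1 * γ S₃.1) = _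
    rw [h12, Units.val_one]
    have hne := (γ (S₁.1 + S₂.1)).ne_zero
    change α.val.1 S₁ + α.val.1 S₂ + α.val.1 S₃ - _ = _
    field_simp
  · obtain ⟨e, he⟩ := exists_isLabelling l
    rw [norm_algM_apply he]
    change s.1 l ^ 3 = _
    rw [hs he, ← Finset.prod_pow]
    exact Finset.prod_congr rfl fun i _ => hα (e i)
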